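/- Let $\theta\in(0,\pi/6)$ with $\cot\theta\in\sqrt3\,\mathbb{Q}$, let $\mu_0>0$, $c_0>0$ and $\beta_2,K_0,K_2\in\mathbb{R}$. Put $d=(\cos\theta,\sin\theta)$, $k_1=(1,0)$, $k_2=\tfrac12(-1,\sqrt3)$, $k_3=-\tfrac12(1,\sqrt3)$. For real amplitudes $(A,B)\in\mathbb{R}^3\times\mathbb{R}^3=\mathbb{R}^6$ consider the full reduced equations $$A_j'=B_j,\qquad B_j'=-\frac{1}{4(d\cdot k_j)^2}\Big(\mu_0A_j+c_0B_j+\beta_2A_kA_l+\big(K_0A_j^2+K_2(A_k^2+A_l^2)\big)A_j\Big)+R_j^\varepsilon(A,B),$$ where $\{j,k,l\}=\{1,2,3\}$; the leading-order system is the system without the terms $R_j^\varepsilon$. Here $R^\varepsilon=O(\varepsilon)$ is any family of remainders with the following properties: $R^\varepsilon(0)=0$ for all sufficiently small $\varepsilon>0$, and for every $\rho>0$ there is $C$ such that, for all sufficiently small $\varepsilon>0$, $R^\varepsilon$ is $C^1$ on the open ball of radius $\rho$ about $0$, with $|R^\varepsilon|\le C\varepsilon$ and $|DR^\varepsilon|\le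 C\varepsilon$ there. A heteroclinic orbit from $p$ to $q$ is a solution on $\mathbb{R}$ that tends to the equilibrium $p$ as $\Xi\to-\infty$ and to the equilibrium $q\ne p$ as $\Xi\to+\infty$. An equilibrium is hyperbolic if the linearisation there has no eigenvalue on the imaginary axis. A heteroclinic orbit $\gamma$ from $p$ to $0$ of the leading-order system persists if there is $\varepsilon_0>0$ such that for each $\varepsilon\in(0,\varepsilon_0)$ the full reduced equations have an equilibrium $p_\varepsilon$ and a heteroclinic orbit $\gamma_\varepsilon$ from $p_\varepsilon$ to $0$, and $p_\varepsilon\to p$ and $\gamma_\varepsilon\to\gamma$ uniformly on $\mathbb{R}$ as $\varepsilon\to0$. Theorem. (1) The stable manifold of the trivial equilibrium $0$ of the leading-order system, i.e. the set of all initial values whose forward solutions converge to $0$, is open in $\mathbb{R}^6$. It is thus six-dimensional, and hence transversal at every point where it meets an unstable manifold. (2) Every heteroclinic orbit of the leading-order system from a hyperbolic equilibrium to the trivial equilibrium $0$ persists. (3) In particular, let $\beta_2\ge0$, $K_0<0$ and $K_2<0$, and put $$\mu_1=-\frac{\beta_2^2K_0}{2\sqrt2\sqrt{K_0(K_0+K_2)^3}-2K_0(K_0+3K_2)}.$$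 If $K_2<K_0$, or if $K_0<K_2$ and $\mu_0<\mu_1$, then every heteroclinic orbit of the leading-order system to $0$ from the down-hexagon equilibrium $A=(a,a,a)$, $B=0$, $a=\frac{-\beta_2+\sqrt{\beta_2^2-4\mu_0(K_0+2K_2)}}{2(K_0+2K_2)}$, persists. If $K_0<K_2$ and $\mu_0>\mu_1$, then every heteroclinic orbit of the leading-order system to $0$ from either of the roll-wave equilibria $A=(\pm\sqrt{-\mu_0/K_0},0,0)$, $B=0$, persists. (No hyperbolicity is assumed in (3).) -/

import Mathlib

open Filter Topology

namespace HexInterface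

/-- The phase space `ℝ³ × ℝ³ = ℝ⁶` of real amplitudes `(A, B)`; the index `j : Fin 3` stands for the
wave vector `k_{j+1}`. -/
abbrev Phase : Type := (Fin 3 → ℝ) × (Fin 3 → ℝ)

/-- The generators `k₁, k₂, k₃` of the hexagonal Fourier lattice. -/
noncomputable def waveVector : Fin 3 → (Fin 2 → ℝ) :=
  ![![1, 0], ![-(1 / 2), √3 / 2], ![-(1 / 2), -(√3 / 2)]]

/-- The direction `d = (cos θ, sin θ)` of propagation. -/
noncomputable def direction (θ : ℝ) : Fin 2 → ℝ := ![Real.cos θ, Real.sin θ]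

/-- The diffusion coefficient `4 (d · k_j)²`. -/
noncomputable def diffusion (θ : ℝ) (j : Fin 3) : ℝ :=
  4 * (direction θ ⬝ᵥ waveVector j) ^ 2

/-- Right-hand side of the leading-order first-order system for real amplitudes,
`A_j' = B_j`,
`B_j' = -(μ₀ A_j + c₀ B_j + β₂ A_k A_l + (K₀ A_j² + K₂ (A_k² + A_l²)) A_j) / (4 (d · k_j)²)`,
where `{j, k, l} = {1, 2, 3}` (addition in `Fin 3` is cyclic). -/
noncomputable def leadingField (θ μ₀ c₀ β₂ K₀ K₂ : ℝ) (x : Phase) : Phase :=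
  (x.2, fun j =>
    -(μ₀ / diffusion θ j) * x.1 j - (c₀ / diffusion θ j) * x.2 j
      - (1 / diffusion θ j) * (β₂ * (x.1 (j + 1) * x.1 (j + 2))
          + (K₀ * x.1 j ^ 2 + K₂ * (x.1 (j + 1) ^ 2 + x.1 (j + 2) ^ 2)) * x.1 j))

/-- The meaning of the `O(ε)` terms in the equations for `B`: a family `R ε` of maps
`ℝ⁶ → ℝ³` which, on every ball and for all small `ε > 0`, is continuously differentiable and of size
`O(ε)` together with its first derivative, and which leaves the trivial state an equilibrium. Nothing
is asked of `R ε` outside a given ball until `ε` is small. -/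
structure IsOrderEps (R : ℝ → Phase → (Fin 3 → ℝ)) : Prop where
  zero_at_trivial : ∀ᶠ ε in 𝓝[>] (0 : ℝ), R ε 0 = 0
  small_on_balls : ∀ ρ : ℝ, 0 < ρ → ∃ C : ℝ, ∀ᶠ ε in 𝓝[>] (0 : ℝ),
    ContDiffOn ℝ 1 (R ε) (Metric.ball 0 ρ) ∧
      ∀ x ∈ Metric.ball (0 : Phase) ρ, ‖R ε x‖ ≤ C * ε ∧ ‖fderiv ℝ (R ε) x‖ ≤ C * ε

/-- Right-hand side of the full reduced system: the leading-order system with the remainder `R ε`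
added to the equations for `B`. -/
noncomputable def fullField (θ μ₀ c₀ β₂ K₀ K₂ : ℝ) (R : ℝ → Phase → (Fin 3 → ℝ)) (ε : ℝ)
    (x : Phase) : Phase :=
  leadingField θ μ₀ c₀ β₂ K₀ K₂ x + (0, R ε x)

/-- `γ` is a heteroclinic orbit of `x' = f x` from the equilibrium `p` to the different
equilibrium `q`. -/
structure IsHeteroclinic (f : Phase → Phase) (γ : ℝ → Phase) (p q : Phase) : Prop where
  ne : p ≠ q
  source_eq : f p = 0
  target_eq : f q = 0
  solution : ∀ t : ℝ, HasDerivAt γ (f (γ t)) t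
  tendsto_source : Tendsto γ atBot (𝓝 p)
  tendsto_target : Tendsto γ atTop (𝓝 q)

/-- `p` is hyperbolic: no complex eigenvalue of the linearisation at `p` is purely imaginary (or
zero). -/
def IsHyperbolicAt (f : Phase → Phase) (p : Phase) : Prop :=
  ∀ z : ℂ, Polynomial.aeval z (fderiv ℝ f p : Phase →ₗ[ℝ] Phase).charpoly = 0 → z.re ≠ 0

/-- The (global) stable manifold of `q`: all initial values whose forward solution exists for all
times and converges to `q`. -/
def stableManifold (f : Phase → Phase) (q : Phase) : Set Phase :=
  {x | ∃ γ : ℝ → Phase, γ 0 = x ∧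
    (∀ t ∈ Set.Ici (0 : ℝ), HasDerivWithinAt γ (f (γ t)) (Set.Ici 0) t) ∧
    Tendsto γ atTop (𝓝 q)}

/-- The orbit `γ` from `p` to the trivial state persists for the perturbed fields `f ε`: for all
small `ε > 0` there are an equilibrium `p' ε` of `f ε` and a heteroclinic orbit `γ' ε` of `f ε` from
`p' ε` to the trivial state, with `p' ε → p`, and `γ' ε → γ` uniformly on `ℝ`, as `ε → 0`. -/
def Persists (f : ℝ → Phase → Phase) (γ : ℝ → Phase) (p : Phase) : Prop :=
  ∃ ε₀ : ℝ, 0 < ε₀ ∧ ∃ (p' : ℝ → Phase) (γ' : ℝ → ℝ → Phase),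
    (∀ ε ∈ Set.Ioo 0 ε₀, IsHeteroclinic (f ε) (γ' ε) (p' ε) 0) ∧
    Tendsto p' (𝓝[>] 0) (𝓝 p) ∧ TendstoUniformly γ' γ (𝓝[>] 0)

/-- The roll-wave equilibria `(A_R, 0)`, `A_R = (σ √(-μ₀/K₀), 0, 0)`, with the sign `σ = ±1`. -/
noncomputable def rollWave (μ₀ K₀ σ : ℝ) : Phase := (![σ * √(-μ₀ / K₀), 0, 0], 0)

/-- The down-hexagon equilibrium `(A_{H₋}, 0)`, with all three amplitudes equal. -/
noncomputable def downHexagon (μ₀ β₂ K₀ K₂ : ℝ) : Phase :=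
  (fun _ => (-β₂ + √(β₂ ^ 2 - 4 * μ₀ * (K₀ + 2 * K₂))) / (2 * (K₀ + 2 * K₂)), 0)

/-- The value of `μ₀` at which down-hexagons and roll waves have equal energy (for
`K₀ < K₂ < 0`). -/
noncomputable def muOne (β₂ K₀ K₂ : ℝ) : ℝ :=
  -(β₂ ^ 2 * K₀) / (2 * √2 * √(K₀ * (K₀ + K₂) ^ 3) - 2 * K₀ * (K₀ + 3 * K₂))

end HexInterface

/-! Near the trivial state the leading-order system consists of three damped oscillators `D A'' + c₀
A' + μ₀ A = 0` plus higher-order terms. Since `μ₀`, `c₀` and all `D` are positive, `0` is a sink. A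
quadratic Lyapunov function shows this with margins that survive small perturbations of the field,
both in size and in Lipschitz constant. Hence every initial value close to a point of an orbit
tending to `0` also flows to `0`, under the unperturbed field (part 1) and under the full field
(`exists_perturbed_forward_orbit`).

For persistence no transversality argument is then needed: any perturbed solution on `(-∞, T]` that
stays close to `γ` may be continued forward from time `T`. The backward half comes from
`exists_perturbed_backward_orbit`. Hyperbolicity of `p` gives a bounded right inverse of `d/dt - L`
on bounded functions on the line, and a contraction argument yields a correction `w` with `γ + w` a
perturbed solution. Working in functions that have a limit at `-∞` produces the perturbed
equilibrium as that limit, so it need not be constructed beforehand. The right inverse is built from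
the scalar equations `y' = z y + f`, one for each eigenvalue, and Cayley–Hamilton; no splitting into
stable and unstable subspaces occurs.

In part 3 hyperbolicity is proved. The linearised reaction terms are symmetric and `c₀ > 0`, so an
imaginary eigenvalue must be `0`, and it remains to see that the linearised reaction terms are
injective. They can fail to be so at one exceptional value of `μ₀` for each pattern, and `muOne`
lies between these two values. -/

namespace HexInterface

open MeasureTheory BoundedContinuousFunction

/-! ### Bounded solutions of the scalar equations `y' = z y + f` -/

section ScalarInverse

variable {E : Type*} [NormedAddCommGroup E] [NormedSpace ℂ E]

/-- Convolution with the decaying exponential `s ↦ exp (z s)`, `s > 0`. -/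
noncomputable def expConv (z : ℂ) (f : ℝ → E) (t : ℝ) : E :=
  ∫ s in Set.Ioi (0 : ℝ), Complex.exp (z * s) • f (t - s)

theorem norm_exp_mul_ofReal (z : ℂ) (s : ℝ) : ‖Complex.exp (z * s)‖ = Real.exp (z.re * s) := by
  rw [Complex.norm_exp]; simp

theorem integrableOn_expConv_bound {z : ℂ} (hz : z.re < 0) (M : ℝ) :
    Integrable (fun s : ℝ => Real.exp (z.re * s) * M) (volume.restrict (Set.Ioi 0)) :=
  (integrableOn_exp_mul_Ioi hz 0).mul_const M

theorem norm_exp_smul_le (z : ℂ) (f : ℝ →ᵇ E) (t s : ℝ) :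
    ‖Complex.exp (z * s) • f (t - s)‖ ≤ Real.exp (z.re * s) * ‖f‖ := by
  rw [norm_smul, norm_exp_mul_ofReal]
  gcongr
  exact f.norm_coe_le_norm _

theorem aestronglyMeasurable_expConv (z : ℂ) (f : ℝ →ᵇ E) (t : ℝ) :
    AEStronglyMeasurable (fun s : ℝ => Complex.exp (z * s) • f (t - s))
      (volume.restrict (Set.Ioi 0)) := by
  have : Continuous fun s : ℝ => Complex.exp (z * s) • f (t - s) := by fun_prop
  exact this.aestronglyMeasurable

theorem integrable_expConv {z : ℂ} (hz : z.re < 0) (f : ℝ →ᵇ E) (t : ℝ) :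
    Integrable (fun s : ℝ => Complex.exp (z * s) • f (t - s))
      (volume.restrict (Set.Ioi 0)) :=
  (integrableOn_expConv_bound hz ‖f‖).mono' (aestronglyMeasurable_expConv z f t)
    (Eventually.of_forall fun s => norm_exp_smul_le z f t s)

theorem norm_expConv_le {z : ℂ} (hz : z.re < 0) (f : ℝ →ᵇ E) (t : ℝ) :
    ‖expConv z f t‖ ≤ (∫ s in Set.Ioi (0 : ℝ), Real.exp (z.re * s)) * ‖f‖ := by
  rw [← integral_mul_const]
  exact norm_integral_le_of_norm_le (integrableOn_expConv_bound hz ‖f‖)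
    (Eventually.of_forall fun s => norm_exp_smul_le z f t s)

theorem tendsto_expConv {z : ℂ} (hz : z.re < 0) (f : ℝ →ᵇ E) {l : Filter ℝ}
    [l.IsCountablyGenerated] (hl : ∀ s : ℝ, Tendsto (fun t => t - s) l l) {c : E}
    (hf : Tendsto f l (𝓝 c)) : ∃ c', Tendsto (expConv z f) l (𝓝 c') :=
  ⟨_, tendsto_integral_filter_of_dominated_convergence _
    (Eventually.of_forall fun t => aestronglyMeasurable_expConv z f t)
    (Eventually.of_forall fun t => Eventually.of_forall fun s => norm_exp_smul_le z f t s)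
    (integrableOn_expConv_bound hz ‖f‖)
    (Eventually.of_forall fun s => (hf.comp (hl s)).const_smul _)⟩

theorem integrableOn_exp_neg_smul {z : ℂ} (hz : z.re < 0) (f : ℝ →ᵇ E) (t : ℝ) :
    IntegrableOn (fun u : ℝ => Complex.exp (-(z * u)) • f u) (Set.Iic t) := by
  have hb : IntegrableOn (fun s : ℝ => Real.exp (-z.re * s) * ‖f‖) (Set.Iic t) :=
    (integrableOn_exp_mul_Iic (by linarith) t).mul_const _
  refine hb.mono' ?_ (Eventually.of_forall fun s => ?_)
  · have : Continuous fun u : ℝ => Complex.exp (-(z * u)) • f u := by fun_prop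
    exact this.aestronglyMeasurable
  · rw [norm_smul, ← neg_mul, norm_exp_mul_ofReal, Complex.neg_re]
    gcongr
    exact f.norm_coe_le_norm _

/-- A bounded right inverse of `d/dt - z`, on bounded continuous functions on the line, which
preserves limits at both ends and commutes with constant operators. -/
structure IsScalarInverse (z : ℂ) (K : (ℝ →ᵇ E) →L[ℂ] (ℝ →ᵇ E)) : Prop where
  hasDerivAt : ∀ f t, HasDerivAt (K f) (z • K f t + f t) t
  tendsto_atBot : ∀ (f : ℝ →ᵇ E) (c : E), Tendsto f atBot (𝓝 c) → ∃ c', Tendsto (K f) atBot (𝓝 c')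
  tendsto_atTop : ∀ (f : ℝ →ᵇ E) (c : E), Tendsto f atTop (𝓝 c) → ∃ c', Tendsto (K f) atTop (𝓝 c')
  comm : ∀ (P : E →L[ℂ] E) f, K (P.compLeftContinuousBounded ℝ f)
    = P.compLeftContinuousBounded ℝ (K f)

/-- Reversal of time on bounded continuous functions on the line. -/
noncomputable def timeReversal : (ℝ →ᵇ E) →L[ℂ] (ℝ →ᵇ E) :=
  LinearMap.mkContinuous
    { toFun := fun f => f.compContinuous ⟨fun t => -t, continuous_neg⟩
      map_add' := fun _ _ => rfl
      map_smul' := fun _ _ => rfl } 1 fun f => by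
    rw [one_mul]
    exact (BoundedContinuousFunction.norm_le (norm_nonneg _)).2 fun t => f.norm_coe_le_norm _

/-- Substituting `u = t - s` gives the variation-of-constants form, in which `t` enters only through
a factor and an endpoint, so that it can be differentiated without regularity of `f`. -/
theorem expConv_eq (z : ℂ) (f : ℝ → E) (t : ℝ) :
    expConv z f t = Complex.exp (z * t) • ∫ u in Set.Iic t, Complex.exp (-(z * u)) • f u := by
  have h := (Measure.measurePreserving_sub_left (volume : Measure ℝ) t).setIntegral_preimage_emb
    (Homeomorph.subLeft t).measurableEmbedding
    (fun u : ℝ => Complex.exp (z * t) • Complex.exp (-(z * u)) • f u) (Set.Iio t)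
  have hs : (fun s : ℝ => t - s) ⁻¹' Set.Iio t = Set.Ioi 0 := by ext s; simp
  rw [hs] at h
  rw [integral_Iic_eq_integral_Iio, ← integral_smul, ← h, expConv]
  refine integral_congr_ae (Eventually.of_forall fun s => ?_)
  simp only [smul_smul, ← Complex.exp_add]
  congr 2
  push_cast; ring

variable [CompleteSpace E]

theorem hasDerivAt_expConv {z : ℂ} (hz : z.re < 0) (f : ℝ →ᵇ E) (t : ℝ) :
    HasDerivAt (expConv z f) (z • expConv z f t + f t) t := by
  set g : ℝ → E := fun u : ℝ => Complex.exp (-(z * u)) • f u with hg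
  have hgc : Continuous g := by fun_prop
  have h1 : HasDerivAt (fun t => ∫ u in Set.Iic t, g u) (g t) t := by
    have : (fun t => ∫ u in Set.Iic t, g u) =
        fun t => (∫ u in Set.Iic 0, g u) + ∫ u in (0 : ℝ)..t, g u := by
      ext t
      rw [← intervalIntegral.integral_Iic_sub_Iic (integrableOn_exp_neg_smul hz f 0)
        (integrableOn_exp_neg_smul hz f t)]
      abel
    rw [this]
    exact (intervalIntegral.integral_hasDerivAt_right (hgc.intervalIntegrable _ _)
      (hgc.stronglyMeasurableAtFilter _ _) hgc.continuousAt).const_add _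
  have h2 : HasDerivAt (fun t : ℝ => Complex.exp (z * t)) (Complex.exp (z * t) * z) t := by
    have : HasDerivAt (fun t : ℝ => z * (t : ℂ)) (z * 1) t :=
      (Complex.ofRealCLM.hasDerivAt (x := t)).const_mul z
    simpa using this.cexp
  have h3 := h2.smul h1
  have he : expConv z f = fun t : ℝ => Complex.exp (z * t) • ∫ u in Set.Iic t, g u := by
    ext t; exact expConv_eq z f t
  rw [he]
  convert h3 using 1
  · rfl
  · simp only [hg, smul_smul, ← Complex.exp_add]
    rw [add_neg_cancel, Complex.exp_zero, one_smul, mul_comm z, add_comm]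

theorem exists_isScalarInverse_of_neg {z : ℂ} (hz : z.re < 0) :
    ∃ K : (ℝ →ᵇ E) →L[ℂ] (ℝ →ᵇ E), IsScalarInverse z K := by
  let K₀ : (ℝ →ᵇ E) →ₗ[ℂ] (ℝ →ᵇ E) :=
    { toFun := fun f => BoundedContinuousFunction.ofNormedAddCommGroup (expConv z f)
        (continuous_iff_continuousAt.2 fun t => (hasDerivAt_expConv hz f t).continuousAt) _
        (norm_expConv_le hz f)
      map_add' := fun f g => by
        ext t
        simp only [BoundedContinuousFunction.coe_ofNormedAddCommGroup,
          BoundedContinuousFunction.coe_add, Pi.add_apply, expConv, smul_add]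
        exact integral_add (integrable_expConv hz f t) (integrable_expConv hz g t)
      map_smul' := fun a f => by
        ext t
        simp only [BoundedContinuousFunction.coe_ofNormedAddCommGroup,
          BoundedContinuousFunction.coe_smul, RingHom.id_apply, expConv, smul_comm _ a]
        exact integral_smul a _ }
  have hK : ∀ f : ℝ →ᵇ E, ‖K₀ f‖ ≤ (∫ s in Set.Ioi (0 : ℝ), Real.exp (z.re * s)) * ‖f‖ :=
    fun f => (BoundedContinuousFunction.norm_le (mul_nonneg
      (integral_nonneg fun s => (Real.exp_pos _).le) (norm_nonneg _))).2 (norm_expConv_le hz f)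
  refine ⟨K₀.mkContinuous _ hK, fun f t => hasDerivAt_expConv hz f t, fun f c h => ?_,
    fun f c h => ?_, fun P f => ?_⟩
  · exact tendsto_expConv hz f (fun s => tendsto_atBot_add_const_right _ (-s) tendsto_id) h
  · exact tendsto_expConv hz f (fun s => tendsto_atTop_add_const_right _ (-s) tendsto_id) h
  · ext t
    have := P.integral_comp_comm (integrable_expConv hz f t)
    simp only [map_smul] at this
    exact this

/-- If `z.re > 0`, reversing time turns `d/dt - z` into `-(d/dt + z)`, which falls under the
decaying case. The two ends of the line change places, which is why limits are tracked at both. -/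
theorem exists_isScalarInverse {z : ℂ} (hz : z.re ≠ 0) :
    ∃ K : (ℝ →ᵇ E) →L[ℂ] (ℝ →ᵇ E), IsScalarInverse z K := by
  rcases lt_or_gt_of_ne hz with h | h
  · exact exists_isScalarInverse_of_neg h
  obtain ⟨K, hK⟩ := exists_isScalarInverse_of_neg (E := E) (z := -z) (by simpa using h)
  refine ⟨-(timeReversal ∘L K ∘L timeReversal), fun f t => ?_, fun f c hf => ?_, fun f c hf => ?_,
    fun P f => ?_⟩
  · have h1 := (HasDerivAt.scomp t (hK.hasDerivAt (timeReversal f) (-t)) (hasDerivAt_neg t)).neg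
    convert h1 using 1
    · rfl
    · change z • (-(K (timeReversal f) (-t))) + f t
        = -((-1 : ℝ) • (-z • K (timeReversal f) (-t) + f (- -t)))
      simp [add_comm]
  · obtain ⟨c', hc'⟩ := hK.tendsto_atTop (timeReversal f) c (hf.comp tendsto_neg_atTop_atBot)
    exact ⟨-c', (hc'.comp tendsto_neg_atBot_atTop).neg⟩
  · obtain ⟨c', hc'⟩ := hK.tendsto_atBot (timeReversal f) c (hf.comp tendsto_neg_atBot_atTop)
    exact ⟨-c', (hc'.comp tendsto_neg_atTop_atBot).neg⟩
  · have h1 : timeReversal (P.compLeftContinuousBounded ℝ f)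
        = P.compLeftContinuousBounded ℝ (timeReversal f) := rfl
    ext t
    simp [h1, hK.comm]
    rfl

end ScalarInverse

/-! ### Inverting `d/dt - L` for hyperbolic `L` -/

section HyperbolicInverse

/-- A bounded right inverse of `d/dt - L` on bounded continuous functions on the line, which
preserves limits at `-∞`. -/
structure IsRightInverse {V : Type*} [NormedAddCommGroup V] [NormedSpace ℝ V]
    (L : V →L[ℝ] V) (S : (ℝ →ᵇ V) →L[ℝ] (ℝ →ᵇ V)) : Prop where
  hasDerivAt : ∀ f t, HasDerivAt (S f) (L (S f t) + f t) t
  tendsto_atBot : ∀ (f : ℝ →ᵇ V) (c : V), Tendsto f atBot (𝓝 c) →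
    ∃ c', Tendsto (S f) atBot (𝓝 c')

/-- The residual `P (T f)` is removed one eigenvalue at a time. If `K` inverts `d/dt - z`, then
`d/dt - L` sends `P (K (T f))` to `P (T f) - (L - z) P (K (T f))`. Adding this function to `S f`
cancels the old residual and leaves one with the additional factor `L - z`. Once the list contains
all roots of the characteristic polynomial, the product vanishes. -/
theorem exists_inverse_with_residual {E : Type*} [NormedAddCommGroup E] [NormedSpace ℂ E]
    [CompleteSpace E] (L : E →L[ℂ] E) (l : List ℂ) (hl : ∀ z ∈ l, z.re ≠ 0) :
    ∃ S T : (ℝ →ᵇ E) →L[ℂ] (ℝ →ᵇ E),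
      (∀ f t, HasDerivAt (S f)
        (L (S f t) + f t - (l.map fun z => L - algebraMap ℂ (E →L[ℂ] E) z).prod (T f t)) t) ∧
      (∀ (f : ℝ →ᵇ E) (c : E), Tendsto f atBot (𝓝 c) → ∃ c', Tendsto (S f) atBot (𝓝 c')) ∧
      (∀ (f : ℝ →ᵇ E) (c : E), Tendsto f atBot (𝓝 c) → ∃ c', Tendsto (T f) atBot (𝓝 c')) := by
  induction l with
  | nil =>
    refine ⟨0, ContinuousLinearMap.id ℂ _, fun f t => ?_, fun f c _ => ⟨0, ?_⟩, fun f c h => ⟨c, h⟩⟩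
    · simp
    · exact tendsto_const_nhds
  | cons z l ih =>
    obtain ⟨S, T, h1, h2, h3⟩ := ih fun w hw => hl w (List.mem_cons_of_mem _ hw)
    obtain ⟨K, hK⟩ := exists_isScalarInverse (E := E) (hl z List.mem_cons_self)
    set P : E →L[ℂ] E := (l.map fun z => L - algebraMap ℂ (E →L[ℂ] E) z).prod with hP
    refine ⟨S + (P.compLeftContinuousBounded ℝ) ∘L K ∘L T, K ∘L T, fun f t => ?_, fun f c hf => ?_,
      fun f c hf => ?_⟩
    · have h4 := hK.hasDerivAt (P.compLeftContinuousBounded ℝ (T f)) t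
      rw [hK.comm] at h4
      have h5 := (h1 f t).add h4
      convert h5 using 1
      · rfl
      · have h6 : algebraMap ℂ (E →L[ℂ] E) z = z • 1 := Algebra.algebraMap_eq_smul_one z
        rw [List.map_cons, List.prod_cons, ← hP, h6]
        change L (S f t + P (K (T f) t)) + f t - (L (P (K (T f) t)) - z • P (K (T f) t))
          = L (S f t) + f t - P (T f t) + (z • P (K (T f) t) + P (T f t))
        rw [map_add]
        abel
    · obtain ⟨a, ha⟩ := h2 f c hf
      obtain ⟨b, hb⟩ := h3 f c hf
      obtain ⟨d, hd⟩ := hK.tendsto_atBot _ _ hb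
      exact ⟨a + P d, ha.add ((P.continuous.tendsto d).comp hd)⟩
    · obtain ⟨b, hb⟩ := h3 f c hf
      exact hK.tendsto_atBot _ _ hb

variable {V : Type*} [NormedAddCommGroup V] [NormedSpace ℝ V] [FiniteDimensional ℝ V]

theorem exists_isRightInverse (L : V →L[ℝ] V)
    (hL : ∀ z : ℂ, Polynomial.aeval z (L : V →ₗ[ℝ] V).charpoly = 0 → z.re ≠ 0) :
    ∃ S : (ℝ →ᵇ V) →L[ℝ] (ℝ →ᵇ V), IsRightInverse L S := by
  classical
  let b := Module.finBasis ℝ V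
  let n := Fin (Module.finrank ℝ V)
  let M : Matrix n n ℝ := LinearMap.toMatrix b b (L : V →ₗ[ℝ] V)
  let Mc : Matrix n n ℂ := M.map (algebraMap ℝ ℂ)
  let Lc : (n → ℂ) →L[ℂ] (n → ℂ) := LinearMap.toContinuousLinearMap (Matrix.toLin' Mc)
  have hchar : Mc.charpoly = (L : V →ₗ[ℝ] V).charpoly.map (algebraMap ℝ ℂ) := by
    rw [← LinearMap.charpoly_toMatrix (L : V →ₗ[ℝ] V) b, ← Matrix.charpoly_map]
  let l : List ℂ := Mc.charpoly.roots.toList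
  have hl : ∀ z ∈ l, z.re ≠ 0 := fun z hz => by
    have hz' : z ∈ Mc.charpoly.roots := by simpa [l] using hz
    have := (Polynomial.mem_roots'.1 hz').2
    rw [hchar, Polynomial.IsRoot, Polynomial.eval_map_algebraMap] at this
    exact hL z this
  -- Cayley–Hamilton for the matrix, factored over `ℂ` and carried to operators by an algebra
  -- homomorphism.
  have hprod : (l.map fun z => Lc - algebraMap ℂ ((n → ℂ) →L[ℂ] (n → ℂ)) z).prod = 0 := by
    have h1 : Mc.charpoly = (l.map fun z => Polynomial.X - Polynomial.C z).prod := by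
      conv_lhs => rw [(IsAlgClosed.splits Mc.charpoly).eq_prod_roots_of_monic
        (Matrix.charpoly_monic _)]
      rw [← Multiset.prod_coe, ← Multiset.map_coe, Multiset.coe_toList]
    have h2 := Matrix.aeval_self_charpoly Mc
    rw [h1, map_list_prod, List.map_map] at h2
    let φ : Matrix n n ℂ →ₐ[ℂ] ((n → ℂ) →L[ℂ] (n → ℂ)) :=
      ((Module.End.toContinuousLinearMap (n → ℂ)).toAlgHom.comp Matrix.toLinAlgEquiv'.toAlgHom)
    have h3 := congrArg φ h2
    rw [map_list_prod, List.map_map, map_zero] at h3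
    rw [← h3]
    congr 2
    ext1 z
    simp [AlgHom.commutes]
    rfl
  obtain ⟨S, T, hS, hlim, -⟩ := exists_inverse_with_residual Lc l hl
  -- The complex inverse is brought back to `V` by embedding the real coordinates and taking real
  -- parts at the end; `Re` intertwines `Lc` with `L` because the matrix is real.
  let J : V →L[ℝ] (n → ℂ) :=
    ContinuousLinearMap.pi fun i => Complex.ofRealCLM ∘L LinearMap.toContinuousLinearMap (b.coord i)
  let Re : (n → ℂ) →L[ℝ] V :=
    ∑ i, (Complex.reCLM ∘L ContinuousLinearMap.proj (R := ℝ) (φ := fun _ : n => ℂ) i).smulRight (b i)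
  have hReJ : ∀ v, Re (J v) = v := fun v => by
    simp only [Re, J, _root_.sum_apply]
    simp
  have hReL : ∀ w, Re (Lc w) = L (Re w) := fun w => by
    have h1 : ∀ j, L (b j) = ∑ i, M i j • b i := fun j => by
      have := b.sum_repr (L (b j))
      rw [← this]
      simp [M, LinearMap.toMatrix_apply]
    simp only [Re, _root_.sum_apply, map_sum]
    simp [Lc, Matrix.mulVec, dotProduct, Mc, h1, Finset.sum_smul, Finset.smul_sum, smul_smul]
    rw [Finset.sum_comm]
    simp only [mul_comm]
  refine ⟨(Re.compLeftContinuousBounded ℝ) ∘L (S.restrictScalars ℝ) ∘L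
    (J.compLeftContinuousBounded ℝ), fun f t => ?_, fun f c hf => ?_⟩
  · have h1 := hS (J.compLeftContinuousBounded ℝ f) t
    rw [hprod] at h1
    have h2 := Re.hasFDerivAt.comp_hasDerivAt t h1
    convert h2 using 1
    · rfl
    · change L (Re (S (J.compLeftContinuousBounded ℝ f) t)) + f t
        = Re (Lc (S (J.compLeftContinuousBounded ℝ f) t) + J (f t) - 0)
      rw [sub_zero, map_add, hReL, hReJ]
  · obtain ⟨c', hc'⟩ := hlim (J.compLeftContinuousBounded ℝ f) (J c)
      ((J.continuous.tendsto c).comp hf)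
    exact ⟨Re c', (Re.continuous.tendsto c').comp hc'⟩

/-- The real and imaginary parts of an eigenvector to a purely imaginary eigenvalue. -/
theorem exists_pair_of_aeval_charpoly_eq_zero (L : V →L[ℝ] V) {z : ℂ}
    (hz : Polynomial.aeval z (L : V →ₗ[ℝ] V).charpoly = 0) (hre : z.re = 0) :
    ∃ u v : V, (u ≠ 0 ∨ v ≠ 0) ∧ L u = -z.im • v ∧ L v = z.im • u := by
  classical
  let b := Module.finBasis ℝ V
  let n := Fin (Module.finrank ℝ V)
  let M : Matrix n n ℝ := LinearMap.toMatrix b b (L : V →ₗ[ℝ] V)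
  let Mc : Matrix n n ℂ := M.map (algebraMap ℝ ℂ)
  have hchar : Mc.charpoly = (L : V →ₗ[ℝ] V).charpoly.map (algebraMap ℝ ℂ) := by
    rw [← LinearMap.charpoly_toMatrix (L : V →ₗ[ℝ] V) b, ← Matrix.charpoly_map]
  have hdet : (Matrix.scalar n z - Mc).det = 0 := by
    rw [← Matrix.eval_charpoly, hchar, Polynomial.eval_map_algebraMap, hz]
  obtain ⟨w, hw0, hw⟩ := Matrix.exists_mulVec_eq_zero_iff.2 hdet
  have hw' : ∀ i, ∑ j, (M i j : ℂ) * w j = z * w i := fun i => by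
    have := congrFun hw i
    rw [Matrix.sub_mulVec, Pi.sub_apply] at this
    simp only [Matrix.mulVec, dotProduct, Mc, Matrix.map_apply, Pi.zero_apply] at this
    rw [sub_eq_zero] at this
    refine this.symm.trans ?_
    simp only [Matrix.scalar_apply, Matrix.diagonal_apply, ite_mul, zero_mul]
    exact (Finset.sum_ite_eq _ _ _).trans (if_pos (Finset.mem_univ i))
  have key : ∀ x : n → ℝ, L (∑ j, x j • b j) = ∑ i, (∑ j, M i j * x j) • b i := fun x => by
    have h1 : ∀ j, L (b j) = ∑ i, M i j • b i := fun j => by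
      have := b.sum_repr (L (b j))
      rw [← this]
      simp [M, LinearMap.toMatrix_apply]
    simp only [map_sum, map_smul, h1, Finset.smul_sum, Finset.sum_smul, smul_smul]
    rw [Finset.sum_comm]
    simp only [mul_comm]
  refine ⟨∑ j, (w j).re • b j, ∑ j, (w j).im • b j, ?_, ?_, ?_⟩
  · by_contra! h
    refine hw0 (funext fun i => ?_)
    have h1 := Fintype.linearIndependent_iff.1 b.linearIndependent _ h.1 i
    have h2 := Fintype.linearIndependent_iff.1 b.linearIndependent _ h.2 i
    exact Complex.ext h1 h2
  · rw [key, Finset.smul_sum]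
    refine Finset.sum_congr rfl fun i _ => ?_
    have := congrArg Complex.re (hw' i)
    simp [hre] at this
    rw [this, smul_smul, neg_mul]
  · rw [key, Finset.smul_sum]
    refine Finset.sum_congr rfl fun i _ => ?_
    have := congrArg Complex.im (hw' i)
    simp [hre] at this
    rw [this, smul_smul]

end HyperbolicInverse

/-! ### The perturbed orbit near the source equilibrium -/

section Backward

variable {V : Type*} [NormedAddCommGroup V] [NormedSpace ℝ V] [CompleteSpace V]

/-- Bounded solutions of `w' = L w + h t w` with a limit at `-∞`, where `h` is small and has a small
Lipschitz constant near `0`. -/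
theorem exists_bounded_solution {L : V →L[ℝ] V} {S : (ℝ →ᵇ V) →L[ℝ] (ℝ →ᵇ V)}
    (hS : IsRightInverse L S) {h : ℝ → V → V} {r c κ : ℝ} (hc : 0 ≤ c) (hκ : 0 ≤ κ)
    (hSc : (‖S‖ + 1) * c ≤ 1 / 2) (hr : 2 * (‖S‖ + 1) * κ < r)
    (h_zero : ∀ t, ‖h t 0‖ ≤ κ)
    (h_lip : ∀ t, ∀ x ∈ Metric.ball (0 : V) r, ∀ y ∈ Metric.ball (0 : V) r,
      ‖h t x - h t y‖ ≤ c * ‖x - y‖)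
    (h_cont : ∀ u : ℝ → V, Continuous u → (∀ t, u t ∈ Metric.ball (0 : V) r) →
      Continuous fun t => h t (u t))
    (h_lim : ∀ (u : ℝ → V) (a : V), (∀ t, u t ∈ Metric.ball (0 : V) r) →
      a ∈ Metric.ball (0 : V) r → Tendsto u atBot (𝓝 a) →
      ∃ b, Tendsto (fun t => h t (u t)) atBot (𝓝 b)) :
    ∃ w : ℝ → V, (∀ t, HasDerivAt w (L (w t) + h t (w t)) t) ∧
      (∀ t, ‖w t‖ ≤ 2 * (‖S‖ + 1) * κ) ∧ ∃ a, Tendsto w atBot (𝓝 a) := by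
  set ϱ := 2 * (‖S‖ + 1) * κ with hϱ
  have hS0 : 0 ≤ ‖S‖ := norm_nonneg _
  have hϱ0 : 0 ≤ ϱ := by positivity
  have hball : ∀ w : ℝ →ᵇ V, ‖w‖ ≤ ϱ → ∀ t, w t ∈ Metric.ball (0 : V) r := fun w hw t => by
    rw [mem_ball_zero_iff]
    exact ((w.norm_coe_le_norm t).trans hw).trans_lt hr
  have h0 : (0 : V) ∈ Metric.ball (0 : V) r := by
    rw [mem_ball_zero_iff, norm_zero]; exact hϱ0.trans_lt hr
  have hbound : ∀ t, ∀ x ∈ Metric.ball (0 : V) r, ‖h t x‖ ≤ c * ‖x‖ + κ := fun t x hx => by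
    calc ‖h t x‖ = ‖(h t x - h t 0) + h t 0‖ := by rw [sub_add_cancel]
      _ ≤ ‖h t x - h t 0‖ + ‖h t 0‖ := norm_add_le _ _
      _ ≤ c * ‖x‖ + κ := by
        have := h_lip t x hx 0 h0
        rw [sub_zero] at this
        exact add_le_add this (h_zero t)
  -- The nonlinearity is controlled only near `0`; outside the ball of radius `ϱ` its value is
  -- irrelevant and is set to `0`.
  have hex : ∀ w : ℝ →ᵇ V, ∃ v : ℝ →ᵇ V, ‖w‖ ≤ ϱ → ∀ t, v t = h t (w t) := fun w => by
    by_cases hw : ‖w‖ ≤ ϱ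
    · refine ⟨BoundedContinuousFunction.ofNormedAddCommGroup (fun t => h t (w t))
        (h_cont w w.continuous (hball w hw)) (c * ϱ + κ) fun t => ?_, fun _ t => rfl⟩
      refine (hbound t _ (hball w hw t)).trans ?_
      gcongr
      exact (w.norm_coe_le_norm t).trans hw
    · exact ⟨0, fun h => absurd h hw⟩
  choose N hN using hex
  set D : Set (ℝ →ᵇ V) := {w | ‖w‖ ≤ ϱ ∧ ∃ a, Tendsto w atBot (𝓝 a)} with hD
  have hNnorm : ∀ w ∈ D, ‖N w‖ ≤ c * ϱ + κ := fun w hw =>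
    (BoundedContinuousFunction.norm_le (by positivity)).2 fun t => by
      rw [hN w hw.1 t]
      refine (hbound t _ (hball w hw.1 t)).trans ?_
      gcongr
      exact (w.norm_coe_le_norm t).trans hw.1
  have hNlip : ∀ w ∈ D, ∀ v ∈ D, ‖N w - N v‖ ≤ c * ‖w - v‖ := fun w hw v hv =>
    (BoundedContinuousFunction.norm_le (by positivity)).2 fun t => by
      rw [BoundedContinuousFunction.sub_apply, hN w hw.1 t, hN v hv.1 t]
      refine (h_lip t _ (hball w hw.1 t) _ (hball v hv.1 t)).trans ?_
      gcongr
      exact (w - v).norm_coe_le_norm t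
  -- Half of `ϱ` absorbs the inhomogeneity `κ`, the other half the Lipschitz part.
  have hmaps : Set.MapsTo (fun w => S (N w)) D D := fun w hw => by
    constructor
    · calc ‖S (N w)‖ ≤ ‖S‖ * ‖N w‖ := S.le_opNorm _
        _ ≤ (‖S‖ + 1) * (c * ϱ + κ) := by
          gcongr
          · linarith
          · exact hNnorm w hw
        _ = (‖S‖ + 1) * c * ϱ + ϱ / 2 := by rw [hϱ]; ring
        _ ≤ 1 / 2 * ϱ + ϱ / 2 := by gcongr
        _ = ϱ := by ring
    · obtain ⟨a, ha⟩ := hw.2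
      have har : a ∈ Metric.ball (0 : V) r := by
        rw [mem_ball_zero_iff]
        refine lt_of_le_of_lt (le_of_tendsto ha.norm (Eventually.of_forall fun t => ?_)) hr
        exact (w.norm_coe_le_norm t).trans hw.1
      obtain ⟨b, hb⟩ := h_lim w a (hball w hw.1) har ha
      refine hS.tendsto_atBot (N w) b ?_
      rw [show (N w : ℝ → V) = fun t => h t (w t) from funext (hN w hw.1)]
      exact hb
  -- A uniform limit of functions with a limit at `-∞` has one too: its values near `-∞` form a
  -- Cauchy filter.
  have hclosed : IsClosed D := by
    refine IsClosed.inter (isClosed_le continuous_norm continuous_const) ?_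
    refine isClosed_of_closure_subset fun w hw => ?_
    refine cauchy_map_iff_exists_tendsto.1 (Metric.cauchy_iff.2 ⟨inferInstance, fun ε hε => ?_⟩)
    obtain ⟨v, ⟨a, ha⟩, hv⟩ := Metric.mem_closure_iff.1 hw (ε / 4) (by positivity)
    have hva := Metric.tendsto_nhds.1 ha (ε / 4) (by positivity)
    refine ⟨w '' {t | dist (v t) a < ε / 4}, image_mem_map hva, ?_⟩
    rintro _ ⟨s, hs, rfl⟩ _ ⟨t, ht, rfl⟩
    have h1 := (BoundedContinuousFunction.dist_coe_le_dist (f := w) (g := v) s).trans_lt hv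
    have h2 := (BoundedContinuousFunction.dist_coe_le_dist (f := w) (g := v) t).trans_lt hv
    have h3 := dist_triangle4 (w s) (v s) (v t) (w t)
    have h4 := dist_triangle_right (v s) (v t) a
    rw [dist_comm (v t) (w t)] at h3
    simp only [Set.mem_ofPred_eq] at hs ht
    linarith
  have hcontr : ContractingWith (1 / 2) (hmaps.restrict (fun w => S (N w)) D D) := by
    refine ⟨by norm_num, LipschitzWith.of_dist_le_mul fun w v => ?_⟩
    rw [Subtype.dist_eq, Subtype.dist_eq, Set.MapsTo.val_restrict_apply,
      Set.MapsTo.val_restrict_apply, dist_eq_norm, dist_eq_norm, ← map_sub]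
    calc ‖S (N w - N v)‖ ≤ ‖S‖ * ‖N w - N v‖ := S.le_opNorm _
      _ ≤ (‖S‖ + 1) * (c * ‖(w : ℝ →ᵇ V) - v‖) := by
        gcongr
        · linarith
        · exact hNlip w w.2 v v.2
      _ = (‖S‖ + 1) * c * ‖(w : ℝ →ᵇ V) - v‖ := by ring
      _ ≤ 1 / 2 * ‖(w : ℝ →ᵇ V) - v‖ := by gcongr
      _ = _ := by norm_num
  have h0D : (0 : ℝ →ᵇ V) ∈ D := ⟨by simpa using hϱ0, 0, tendsto_const_nhds⟩
  obtain ⟨w, hwD, hw, -⟩ := hcontr.exists_fixedPoint' hclosed.isComplete hmaps h0D (edist_ne_top _ _)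
  refine ⟨w, fun t => ?_, fun t => (w.norm_coe_le_norm t).trans hwD.1, hwD.2⟩
  have h1 := hS.hasDerivAt (N w) t
  rw [hN w hwD.1] at h1
  have h2 : S (N w) = w := hw
  rwa [h2] at h1

/-- With `y = γ + w` the equation becomes `w' = L w + h t w`, where `h t w = F (γ + w) - F γ - L w +
G (γ + w)`. Strict differentiability at `p` makes its Lipschitz constant small as long as `γ` is
near `p`, that is for `t ≤ T`. The bound `C κ` on `w` is linear in the size of the perturbation. -/
theorem exists_perturbed_backward_orbit {F : V → V} {p : V} {L : V →L[ℝ] V}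
    (hF : HasStrictFDerivAt F L p) (hFc : Continuous F) {S : (ℝ →ᵇ V) →L[ℝ] (ℝ →ᵇ V)}
    (hS : IsRightInverse L S) {γ : ℝ → V} (hγ : ∀ t, HasDerivAt γ (F (γ t)) t)
    (hp : Tendsto γ atBot (𝓝 p)) :
    ∃ T r C κ₀ : ℝ, 0 < r ∧ 0 ≤ C ∧ 0 < κ₀ ∧ ∀ (G : V → V) (κ : ℝ), 0 ≤ κ → κ ≤ κ₀ →
      (∀ x ∈ Metric.ball p r, ‖G x‖ ≤ κ) →
      (∀ x ∈ Metric.ball p r, ∀ y ∈ Metric.ball p r, ‖G x - G y‖ ≤ κ * ‖x - y‖) →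
      ∃ (y : ℝ → V) (l : V), (∀ t ≤ T, HasDerivAt y (F (y t) + G (y t)) t) ∧
        Tendsto y atBot (𝓝 l) ∧ l ∈ Metric.ball p r ∧ ∀ t ≤ T, ‖y t - γ t‖ ≤ C * κ := by
  have hS0 : 0 ≤ ‖S‖ := norm_nonneg _
  set η : ℝ := 1 / (4 * (‖S‖ + 1)) with hη
  have hη0 : 0 < η := by positivity
  have hSη : (‖S‖ + 1) * η = 1 / 4 := by rw [hη]; field_simp
  obtain ⟨r, hr0, hr⟩ : ∃ r > 0, ∀ x ∈ Metric.ball p r, ∀ y ∈ Metric.ball p r,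
      ‖F x - F y - L (x - y)‖ ≤ η * ‖x - y‖ := by
    have h1 := hF.isLittleO.def hη0
    obtain ⟨r, hr0, hr⟩ := Metric.eventually_nhds_iff.1 h1
    refine ⟨r, hr0, fun x hx y hy => hr (y := (x, y)) ?_⟩
    rw [Prod.dist_eq]
    exact max_lt hx hy
  obtain ⟨T, hT⟩ := eventually_atBot.1 (Metric.tendsto_nhds.1 hp (r / 4) (by positivity))
  -- The two bounds on `κ` make the total Lipschitz constant at most `2 η`, a contraction with
  -- factor `1 / 2`, and keep `w` inside the ball of radius `r / 2`.
  refine ⟨T, r, 2 * (‖S‖ + 1), min η (r / (8 * (‖S‖ + 1))), hr0, by positivity, by positivity,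
    fun G κ hκ0 hκ hG hGl => ?_⟩
  have hκη : κ ≤ η := hκ.trans (min_le_left _ _)
  have hκr : 2 * (‖S‖ + 1) * κ < r / 2 := by
    have h1 : κ ≤ r / (8 * (‖S‖ + 1)) := hκ.trans (min_le_right _ _)
    rw [le_div_iff₀ (by positivity)] at h1
    linarith
  -- Freezing `γ` after time `T` keeps it near `p` for all times, so that the problem can be posed
  -- on the whole line; only `t ≤ T` is used afterwards.
  set g : ℝ → V := fun t => γ (min t T) with hg
  have hgc : Continuous g := by
    have : Continuous γ := continuous_iff_continuousAt.2 fun t => (hγ t).continuousAt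
    fun_prop
  have hglim : Tendsto g atBot (𝓝 p) := hp.congr' <| by
    filter_upwards [eventually_le_atBot T] with t ht
    simp [hg, min_eq_left ht]
  have hgb : ∀ t, dist (g t) p < r / 4 := fun t => hT _ (min_le_right _ _)
  have hmem : ∀ t, ∀ x ∈ Metric.ball (0 : V) (r / 2), g t + x ∈ Metric.ball p r := fun t x hx => by
    rw [Metric.mem_ball, dist_eq_norm]
    have h1 := hgb t
    rw [dist_eq_norm] at h1
    rw [mem_ball_zero_iff] at hx
    calc ‖g t + x - p‖ = ‖(g t - p) + x‖ := by congr 1; abel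
      _ ≤ ‖g t - p‖ + ‖x‖ := norm_add_le _ _
      _ < r := by linarith
  have hmem0 : ∀ t, g t ∈ Metric.ball p r := fun t => (hgb t).trans (by linarith)
  have hGc : ContinuousOn G (Metric.ball p r) :=
    (LipschitzOnWith.of_dist_le_mul (K := ⟨κ, hκ0⟩) fun x hx y hy => by
      rw [dist_eq_norm, dist_eq_norm]; exact hGl x hx y hy).continuousOn
  obtain ⟨w, hw, hwb, a, ha⟩ := exists_bounded_solution hS
    (h := fun t x => F (g t + x) - F (g t) - L x + G (g t + x)) (r := r / 2) (c := η + κ) (κ := κ)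
    (by positivity) hκ0 (by nlinarith) hκr (fun t => by simpa using hG _ (hmem0 t))
    (fun t x hx y hy => by
      have h1 := hr _ (hmem t x hx) _ (hmem t y hy)
      have h2 := hGl _ (hmem t x hx) _ (hmem t y hy)
      rw [add_sub_add_left_eq_sub] at h1 h2
      rw [map_sub] at h1
      calc _ = ‖(F (g t + x) - F (g t + y) - (L x - L y)) + (G (g t + x) - G (g t + y))‖ := by
            congr 1; abel
        _ ≤ _ := (norm_add_le _ _).trans (add_le_add h1 h2)
        _ = _ := by ring)
    (fun u hu hub => by
      have h1 : Continuous fun t => G (g t + u t) :=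
        hGc.comp_continuous (hgc.add hu) fun t => hmem t _ (hub t)
      exact (((hFc.comp (hgc.add hu)).sub (hFc.comp hgc)).sub (L.continuous.comp hu)).add h1)
    (fun u a hub har hu => by
      have hpa : p + a ∈ Metric.ball p r := by
        rw [mem_ball_zero_iff] at har
        rw [Metric.mem_ball, dist_eq_norm, add_sub_cancel_left]
        linarith
      have h1 := hglim.add hu
      have h2 := ((hGc.continuousAt (Metric.isOpen_ball.mem_nhds hpa)).tendsto.comp h1)
      exact ⟨_, ((((hFc.tendsto _).comp h1).sub ((hFc.tendsto _).comp hglim)).sub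
        ((L.continuous.tendsto _).comp hu)).add h2⟩)
  refine ⟨fun t => γ t + w t, p + a, fun t ht => ?_, hp.add ha, ?_, fun t ht => ?_⟩
  · have hgt : g t = γ t := by simp [hg, min_eq_left ht]
    have h1 := (hγ t).add (hw t)
    rw [hgt] at h1
    convert h1 using 1
    · rfl
    · change F (γ t + w t) + G (γ t + w t) = _
      abel
  · rw [Metric.mem_ball, dist_eq_norm, add_sub_cancel_left]
    have : ‖a‖ ≤ 2 * (‖S‖ + 1) * κ := le_of_tendsto ha.norm (Eventually.of_forall hwb)
    linarith
  · simpa using hwb t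

end Backward

/-- The limit of a solution of an autonomous equation is an equilibrium. -/
theorem eq_zero_of_tendsto_atBot {V : Type*} [NormedAddCommGroup V] [NormedSpace ℝ V]
    {H : V → V} {y : ℝ → V} {T : ℝ} {l : V} (hy : ∀ t ≤ T, HasDerivAt y (H (y t)) t)
    (hl : Tendsto y atBot (𝓝 l)) (hH : ContinuousAt H l) : H l = 0 := by
  -- The increment over unit time tends to `0`, and by the mean value inequality also to `H l`.
  have h1 : Tendsto (fun t => y t - y (t - 1)) atBot (𝓝 (l - l)) :=
    hl.sub (hl.comp (tendsto_atBot_add_const_right _ (-1) tendsto_id))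
  rw [sub_self] at h1
  refine tendsto_nhds_unique ?_ h1
  rw [Metric.tendsto_nhds]
  intro ε hε
  have h2 := Metric.tendsto_nhds.1 (hH.tendsto.comp hl) (ε / 2) (by positivity)
  obtain ⟨T', hT'⟩ := eventually_atBot.1 h2
  filter_upwards [eventually_le_atBot (min T T')] with t ht
  have ht1 : t ≤ T := ht.trans (min_le_left _ _)
  have ht2 : t ≤ T' := ht.trans (min_le_right _ _)
  have h3 := (convex_Icc (t - 1) t).norm_image_sub_le_of_norm_hasDerivWithin_le
    (f := fun s => y s - s • H l) (f' := fun s => H (y s) - H l) (C := ε / 2)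
    (x := t - 1) (y := t) (fun s hs => ?_) (fun s hs => ?_) (by simp) (by simp)
  · have h4 : (y t - t • H l - (y (t - 1) - (t - 1) • H l)) = y t - y (t - 1) - H l := by
      rw [sub_smul, one_smul]; abel
    rw [h4] at h3
    rw [dist_eq_norm]
    simp at h3
    linarith
  · exact ((hy s (hs.2.trans ht1)).sub (by simpa using (hasDerivAt_id s).smul_const (H l))).hasDerivWithinAt
  · rw [← dist_eq_norm]
    exact (hT' s (hs.2.trans ht2)).le

/-! ### The perturbed orbit in the basin of the trivial state -/

section Forward

/-- Coordinatewise truncation of the phase space to the cube of side `2 ρ`. -/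
def clamp (ρ : ℝ) (x : Phase) : Phase :=
  (fun i => max (-ρ) (min ρ (x.1 i)), fun i => max (-ρ) (min ρ (x.2 i)))

theorem dist_clamp_le (ρ : ℝ) (x y : Phase) : dist (clamp ρ x) (clamp ρ y) ≤ dist x y := by
  have h : LipschitzWith 1 fun s : ℝ => max (-ρ) (min ρ s) :=
    (LipschitzWith.id.const_min ρ).const_max (-ρ)
  have h' : ∀ a b : ℝ, dist (max (-ρ) (min ρ a)) (max (-ρ) (min ρ b)) ≤ dist a b := fun a b => by
    simpa using h.dist_le_mul a b
  rw [Prod.dist_eq, Prod.dist_eq]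
  refine max_le_max ?_ ?_ <;> refine (dist_pi_le_iff dist_nonneg).2 fun i => (h' _ _).trans ?_
  · exact dist_le_pi_dist x.1 y.1 i
  · exact dist_le_pi_dist x.2 y.2 i

theorem norm_clamp_le {ρ : ℝ} (hρ : 0 ≤ ρ) (x : Phase) : ‖clamp ρ x‖ ≤ ρ := by
  have h : ∀ a : ℝ, ‖max (-ρ) (min ρ a)‖ ≤ ρ := fun a => by
    rw [Real.norm_eq_abs, abs_le]
    exact ⟨le_max_left _ _, max_le (by linarith) (min_le_left _ _)⟩
  rw [Prod.norm_def]
  exact max_le ((pi_norm_le_iff_of_nonneg hρ).2 fun i => h _)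
    ((pi_norm_le_iff_of_nonneg hρ).2 fun i => h _)

theorem clamp_eq_self {ρ : ℝ} {x : Phase} (hx : ‖x‖ ≤ ρ) : clamp ρ x = x := by
  have h : ∀ a : ℝ, ‖a‖ ≤ ρ → max (-ρ) (min ρ a) = a := fun a ha => by
    rw [Real.norm_eq_abs, abs_le] at ha
    rw [min_eq_right ha.2, max_eq_right ha.1]
  refine Prod.ext (funext fun i => h _ ?_) (funext fun i => h _ ?_)
  · exact (norm_le_pi_norm x.1 i).trans ((norm_fst_le x).trans hx)
  · exact (norm_le_pi_norm x.2 i).trans ((norm_snd_le x).trans hx)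

/-- Solutions of an autonomous equation with a bounded, Lipschitz right-hand side are global. -/
theorem exists_global_solution {V : Type*} [NormedAddCommGroup V] [NormedSpace ℝ V]
    [CompleteSpace V] {H : V → V} {K : NNReal} {M : ℝ} (hH : LipschitzWith K H)
    (hM : ∀ x, ‖H x‖ ≤ M) (t₀ : ℝ) (x₀ : V) :
    ∃ y : ℝ → V, y t₀ = x₀ ∧ ∀ t, HasDerivAt y (H (y t)) t := by
  have hM0 : 0 ≤ M := (norm_nonneg _).trans (hM x₀)
  have hloc : ∀ n : ℕ, ∃ α : ℝ → V, α 0 = x₀ ∧ ∀ t ∈ Set.Icc (-(n + 1 : ℝ)) (n + 1),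
      HasDerivWithinAt α (H (α t)) (Set.Icc (-(n + 1 : ℝ)) (n + 1)) t := fun n => by
    have hn : (0 : ℝ) ≤ n := n.cast_nonneg
    -- A field bounded by `M` moves points by at most `M (n + 1)` in time `n + 1`, so a ball of that
    -- radius serves for arbitrarily long intervals; the solutions agree by uniqueness.
    have hpl : IsPicardLindelof (fun _ => H) (tmin := -(n + 1 : ℝ)) (tmax := n + 1)
        ⟨0, by constructor <;> linarith⟩ x₀ ⟨M * (n + 1), by positivity⟩ 0 ⟨M, hM0⟩ K :=
      { lipschitzOnWith := fun t _ => hH.lipschitzOnWith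
        continuousOn := fun x _ => continuousOn_const
        norm_le := fun t _ x _ => hM x
        mul_max_le := by
          simp only [sub_zero, zero_sub, neg_neg, max_self, NNReal.coe_zero]
          exact le_refl (M * (n + 1)) }
    exact hpl.exists_eq_forall_mem_Icc_hasDerivWithinAt₀
  choose α hα0 hα using hloc
  have hagree : ∀ n m : ℕ, n ≤ m → Set.EqOn (α n) (α m) (Set.Icc (-(n + 1 : ℝ)) (n + 1)) :=
    fun n m hnm => by
    have hn : (0 : ℝ) ≤ n := n.cast_nonneg
    have hnm' : (n : ℝ) ≤ m := by exact_mod_cast hnm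
    have hsub : Set.Icc (-(n + 1 : ℝ)) (n + 1) ⊆ Set.Icc (-(m + 1 : ℝ)) (m + 1) :=
      Set.Icc_subset_Icc (by linarith) (by linarith)
    have h1 : ∀ t ∈ Set.Ioo (-(n + 1 : ℝ)) (n + 1), HasDerivAt (α n) (H (α n t)) t := fun t ht =>
      (hα n t (Set.Ioo_subset_Icc_self ht)).hasDerivAt (Icc_mem_nhds ht.1 ht.2)
    have h2 : ∀ t ∈ Set.Ioo (-(n + 1 : ℝ)) (n + 1), HasDerivAt (α m) (H (α m t)) t := fun t ht =>
      ((hα m t (hsub (Set.Ioo_subset_Icc_self ht))).mono hsub).hasDerivAt (Icc_mem_nhds ht.1 ht.2)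
    exact ODE_solution_unique_of_mem_Icc (v := fun _ => H) (s := fun _ => Set.univ) (K := K)
      (t₀ := 0) (fun t _ => hH.lipschitzOnWith) (by constructor <;> linarith)
      (fun t ht => (hα n t ht).continuousWithinAt) h1 (fun _ _ => trivial)
      (fun t ht => ((hα m t (hsub ht)).mono hsub).continuousWithinAt) h2 (fun _ _ => trivial)
      ((hα0 n).trans (hα0 m).symm)
  let z : ℝ → V := fun t => α ⌈|t|⌉₊ t
  have hz : ∀ n : ℕ, Set.EqOn z (α n) (Set.Icc (-(n + 1 : ℝ)) (n + 1)) := fun n t ht => by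
    have h1 : t ∈ Set.Icc (-((⌈|t|⌉₊ : ℕ) + 1 : ℝ)) ((⌈|t|⌉₊ : ℕ) + 1) := by
      have := abs_le.1 (Nat.le_ceil |t|)
      constructor <;> linarith [this.1, this.2]
    rcases le_total n ⌈|t|⌉₊ with h | h
    · exact (hagree _ _ h ht).symm
    · exact hagree _ _ h h1
  have hzd : ∀ t, HasDerivAt z (H (z t)) t := fun t => by
    have ht := abs_le.1 (Nat.le_ceil |t|)
    have hnb : Set.Icc (-((⌈|t|⌉₊ : ℕ) + 1 : ℝ)) ((⌈|t|⌉₊ : ℕ) + 1) ∈ 𝓝 t :=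
      Icc_mem_nhds (by linarith [ht.1]) (by linarith [ht.2])
    have h1 := (hα ⌈|t|⌉₊ t (mem_of_mem_nhds hnb)).hasDerivAt hnb
    exact h1.congr_of_eventuallyEq ((hz _).eventuallyEq_of_mem hnb)
  refine ⟨fun t => z (t - t₀), ?_, fun t => (hzd (t - t₀)).comp_sub_const t t₀⟩
  simp [z, hα0]

/-- `Q` is a strict quadratic Lyapunov function of the linear equation `x' = L x`; the derivative
of `Q` at `x` in direction `v` is `Q' x v`. -/
structure IsLyapunovForm {V : Type*} [NormedAddCommGroup V] [NormedSpace ℝ V]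
    (L : V →L[ℝ] V) (Q : V → ℝ) (Q' : V → V → ℝ) (m M a : ℝ) : Prop where
  m_pos : 0 < m
  M_pos : 0 < M
  a_pos : 0 < a
  lower : ∀ x, m * ‖x‖ ^ 2 ≤ Q x
  upper : ∀ x, Q x ≤ M * ‖x‖ ^ 2
  hasDeriv : ∀ (y : ℝ → V) (v : V) (t : ℝ) (s : Set ℝ), HasDerivWithinAt y v s t →
    HasDerivWithinAt (fun τ => Q (y τ)) (Q' (y t) v) s t
  add : ∀ x v w, Q' x (v + w) = Q' x v + Q' x w
  bound : ∀ x v, Q' x v ≤ M * ‖x‖ * ‖v‖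
  neg : ∀ x, Q' x (L x) ≤ -a * ‖x‖ ^ 2

/-- A barrier argument. At a contact of `Q (y t)` with the exponential, `y t` lies in the ball of
radius `r`, where the error `H - L` costs at most half of the decay `a`. Thus `Q` decreases at least
at the rate `a / (2 * M)`, twice that of the barrier, and cannot cross it. -/
theorem IsLyapunovForm.le_exp_of_solution {V : Type*} [NormedAddCommGroup V] [NormedSpace ℝ V]
    {L : V →L[ℝ] V} {Q : V → ℝ} {Q' : V → V → ℝ} {m M a : ℝ} (hQ : IsLyapunovForm L Q Q' m M a)
    {H : V → V} {r : ℝ} (hr : 0 < r) (hH : ∀ x, ‖x‖ < r → ‖H x - L x‖ ≤ a / (2 * M) * ‖x‖)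
    {y : ℝ → V} {T β : ℝ} (hy : ∀ t, T ≤ t → HasDerivAt y (H (y t)) t)
    (hβ0 : 0 < β) (hβ : β < m * r ^ 2) (hyT : M * ‖y T‖ ^ 2 ≤ β) (t : ℝ) (ht : T ≤ t) :
    m * ‖y t‖ ^ 2 ≤ β * Real.exp (-(a / (4 * M)) * (t - T)) := by
  have hm := hQ.m_pos
  have hM := hQ.M_pos
  have ha := hQ.a_pos
  refine (hQ.lower _).trans ?_
  have hd : ∀ s, T ≤ s → HasDerivWithinAt (fun τ => Q (y τ)) (Q' (y s) (H (y s))) (Set.Ici s) s :=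
    fun s hs => hQ.hasDeriv y _ s _ (hy s hs).hasDerivWithinAt
  have hc : ContinuousOn (fun τ => Q (y τ)) (Set.Icc T t) := fun s hs =>
    (hQ.hasDeriv y _ s _ (hy s hs.1).hasDerivWithinAt).continuousWithinAt
  refine image_le_of_deriv_right_lt_deriv_boundary
    (f := fun τ => Q (y τ)) (f' := fun s => Q' (y s) (H (y s)))
    (B := fun s => β * Real.exp (-(a / (4 * M)) * (s - T)))
    (B' := fun s => β * (Real.exp (-(a / (4 * M)) * (s - T)) * (-(a / (4 * M)))))
    hc (fun s hs => hd s hs.1) ?_ (fun s => ?_) (fun s hs hs' => ?_)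
    (Set.right_mem_Icc.2 ht)
  · simpa using (hQ.upper (y T)).trans hyT
  · have h1 : HasDerivAt (fun s => -(a / (4 * M)) * (s - T)) (-(a / (4 * M))) s := by
      simpa using ((hasDerivAt_id s).sub_const T).const_mul (-(a / (4 * M)))
    exact h1.exp.const_mul β
  · set e := Real.exp (-(a / (4 * M)) * (s - T)) with he
    have he0 : 0 < e := Real.exp_pos _
    have he1 : e ≤ 1 := Real.exp_le_one_iff.2 (by
      have : 0 ≤ a / (4 * M) * (s - T) := mul_nonneg (by positivity) (by linarith [hs.1])
      linarith)
    change Q (y s) = β * e at hs'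
    set x := y s with hx
    have hxr : ‖x‖ < r := by
      have h1 := hQ.lower x
      rw [hs'] at h1
      have h2 : m * ‖x‖ ^ 2 < m * r ^ 2 := by nlinarith
      exact lt_of_pow_lt_pow_left₀ 2 hr.le (lt_of_mul_lt_mul_left h2 hm.le)
    have h1 : Q' x (H x) = Q' x (L x) + Q' x (H x - L x) := by
      rw [← hQ.add, add_sub_cancel]
    have h2 : Q' x (H x - L x) ≤ M * ‖x‖ * (a / (2 * M) * ‖x‖) :=
      (hQ.bound x _).trans (mul_le_mul_of_nonneg_left (hH x hxr) (by positivity))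
    have h3 : M * ‖x‖ * (a / (2 * M) * ‖x‖) = a / 2 * ‖x‖ ^ 2 := by field_simp
    have h4 := hQ.neg x
    have h5 := hQ.upper x
    rw [hs'] at h5
    have h6 : a / (2 * M) * (β * e) ≤ a / 2 * ‖x‖ ^ 2 := by
      calc a / (2 * M) * (β * e) ≤ a / (2 * M) * (M * ‖x‖ ^ 2) := by gcongr
        _ = a / 2 * ‖x‖ ^ 2 := by field_simp
    have h7 : a / (2 * M) * (β * e) = 2 * (a / (4 * M) * (β * e)) := by field_simp; ring
    have h8 : 0 < a / (4 * M) * (β * e) := by positivity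
    change Q' x (H x) < β * (e * (-(a / (4 * M))))
    rw [h1]
    nlinarith

theorem exists_bound_of_tendsto_atTop {V : Type*} [NormedAddCommGroup V] {γ : ℝ → V} {T : ℝ}
    {l : V} (hγ : ContinuousOn γ (Set.Ici T)) (hl : Tendsto γ atTop (𝓝 l)) :
    ∃ B, 0 ≤ B ∧ ∀ t, T ≤ t → ‖γ t‖ ≤ B := by
  obtain ⟨T', hT'⟩ := eventually_atTop.1 (hl.norm.eventually_lt_const (lt_add_one ‖l‖))
  obtain ⟨B, hB⟩ := isCompact_Icc.exists_bound_of_continuousOn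
    (hγ.mono (Set.Icc_subset_Ici_self : Set.Icc T T' ⊆ _))
  refine ⟨max B (‖l‖ + 1), le_max_of_le_right (by positivity), fun t ht => ?_⟩
  rcases le_total t T' with h | h
  · exact le_max_of_le_left (hB t ⟨ht, h⟩)
  · exact le_max_of_le_right (hT' t h).le

/-- Up to a time `T₁` at which `γ` is close to `0`, Grönwall's inequality keeps the perturbed
solution near `γ`; from then on the Lyapunov function takes over. As `G 0 = 0`, the Lipschitz bound
makes `G` small relative to `‖x‖`, so the perturbed solution still converges to `0` itself. The
radius `ρ` is chosen before `η`, because the constants in the `O(ε)` bounds depend on the ball. -/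
theorem exists_perturbed_forward_orbit {F : Phase → Phase} (hF : ContDiff ℝ 1 F) (hF0 : F 0 = 0)
    {Q : Phase → ℝ} {Q' : Phase → Phase → ℝ} {m M a : ℝ}
    (hQ : IsLyapunovForm (fderiv ℝ F 0) Q Q' m M a) {γ : ℝ → Phase} {T : ℝ}
    (hγ : ∀ t, T ≤ t → HasDerivWithinAt γ (F (γ t)) (Set.Ici T) t)
    (hγ0 : Tendsto γ atTop (𝓝 0)) :
    ∃ ρ > 0, ∀ η > 0, ∃ δ > 0, ∀ G : Phase → Phase, G 0 = 0 →
      (∀ x ∈ Metric.ball (0 : Phase) ρ, ‖G x‖ ≤ δ) →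
      (∀ x ∈ Metric.ball (0 : Phase) ρ, ∀ y ∈ Metric.ball (0 : Phase) ρ,
        ‖G x - G y‖ ≤ δ * ‖x - y‖) →
      ∀ x₀, ‖x₀ - γ T‖ ≤ δ → ∃ y : ℝ → Phase, y T = x₀ ∧
        (∀ t, T ≤ t → HasDerivAt y (F (y t) + G (y t)) t) ∧ Tendsto y atTop (𝓝 0) ∧
        ∀ t, T ≤ t → ‖y t - γ t‖ ≤ η := by
  have hm := hQ.m_pos
  have hM := hQ.M_pos
  have ha := hQ.a_pos
  have hγc : ContinuousOn γ (Set.Ici T) := fun t ht => (hγ t ht).continuousWithinAt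
  obtain ⟨R₀, hR₀, hγR⟩ := exists_bound_of_tendsto_atTop hγc hγ0
  -- The field is truncated outside this radius to obtain global solutions. Since `η ≤ 1`, the
  -- solution never leaves the region where the truncation is inactive.
  set ρ' : ℝ := R₀ + 1 with hρ'
  have hρ'0 : 0 ≤ ρ' := by positivity
  refine ⟨R₀ + 2, by positivity, fun η₀ hη₀ => ?_⟩
  set η : ℝ := min η₀ 1 with hη
  have hη0 : 0 < η := lt_min hη₀ one_pos
  obtain ⟨r₀, hr₀, hFr⟩ : ∃ r₀ > 0, ∀ x : Phase, ‖x‖ < r₀ →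
      ‖F x - fderiv ℝ F 0 x‖ ≤ a / (4 * M) * ‖x‖ := by
    have h1 := ((hF.differentiable one_ne_zero).differentiableAt (x := 0)).hasFDerivAt.isLittleO.def
      (c := a / (4 * M)) (by positivity)
    obtain ⟨r₀, hr₀, h⟩ := Metric.eventually_nhds_iff.1 h1
    refine ⟨r₀, hr₀, fun x hx => ?_⟩
    simpa [hF0] using h (y := x) (by simpa using hx)
  set r : ℝ := min r₀ (η / 2) with hr
  have hr0 : 0 < r := lt_min hr₀ (by positivity)
  have hrη : r ≤ η / 2 := min_le_right _ _
  have hη1 : η ≤ 1 := min_le_right _ _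
  -- The factor `2` occurs because at time `T₁` both `γ` and the deviation from it are bounded by
  -- `r₁`.
  obtain ⟨r₁, hr₁, hr₁r, hr₁β⟩ : ∃ r₁ > 0, r₁ ≤ r / 2 ∧ M * (2 * r₁) ^ 2 ≤ m * r ^ 2 / 2 := by
    have hq0 : 0 < m / (m + M) := by positivity
    have hq1 : m / (m + M) ≤ 1 := (div_le_one (by positivity)).2 (by linarith)
    have hq2 : M * (m / (m + M)) ≤ m := by
      rw [mul_div_assoc', div_le_iff₀ (by positivity)]; nlinarith
    set q := m / (m + M)
    refine ⟨r / 4 * q, by positivity, by nlinarith, ?_⟩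
    have h1 : M * q * q ≤ m := by nlinarith
    have h2 : M * q * q * r ^ 2 ≤ m * r ^ 2 := by gcongr
    nlinarith [mul_pos hm (pow_pos hr0 2)]
  obtain ⟨T₁', hT₁'⟩ := eventually_atTop.1 (Metric.tendsto_nhds.1 hγ0 r₁ hr₁)
  set T₁ := max T T₁' with hT₁
  have hTT₁ : T ≤ T₁ := le_max_left _ _
  have hγr₁ : ∀ t, T₁ ≤ t → ‖γ t‖ < r₁ := fun t ht => by
    simpa using hT₁' t ((le_max_right _ _).trans ht)
  obtain ⟨K, hK⟩ := (hF.contDiffOn (s := Metric.closedBall 0 ρ')).exists_lipschitzOnWith one_ne_zero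
    (convex_closedBall _ _) (isCompact_closedBall _ _)
  have hcl : ∀ x, clamp ρ' x ∈ Metric.closedBall (0 : Phase) ρ' := fun x =>
    mem_closedBall_zero_iff.2 (norm_clamp_le hρ'0 x)
  have hcl' : ∀ x, clamp ρ' x ∈ Metric.ball (0 : Phase) (R₀ + 2) := fun x =>
    mem_ball_zero_iff.2 ((norm_clamp_le hρ'0 x).trans_lt (by rw [hρ']; linarith))
  -- The constant is raised by `1` to be nonzero, as the Grönwall bound divides by it.
  have hFK : LipschitzWith (K + 1) fun x => F (clamp ρ' x) :=
    LipschitzWith.of_dist_le_mul fun x y =>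
      (hK.dist_le_mul _ (hcl x) _ (hcl y)).trans
        (mul_le_mul (by simp) (dist_clamp_le ρ' x y) dist_nonneg (by positivity))
  obtain ⟨BF, hBF⟩ := (isCompact_closedBall (0 : Phase) ρ').exists_bound_of_continuousOn
    hF.continuous.continuousOn
  set k : ℝ := ((K + 1 : NNReal) : ℝ) with hk
  have hk0 : 0 < k := by rw [hk]; positivity
  set Γ : ℝ := Real.exp (k * (T₁ - T)) + 1 / k * (Real.exp (k * (T₁ - T)) - 1) with hΓ
  have hΓ0 : 0 < Γ := by
    have h1 : 1 ≤ Real.exp (k * (T₁ - T)) :=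
      Real.one_le_exp (mul_nonneg hk0.le (by linarith))
    have h2 : 0 ≤ 1 / k * (Real.exp (k * (T₁ - T)) - 1) := mul_nonneg (by positivity) (by linarith)
    linarith
  have hmin : 0 < min r₁ η := lt_min hr₁ hη0
  refine ⟨min (a / (4 * M)) (min r₁ η / Γ), by positivity, fun G hG0 hG hGl x₀ hx₀ => ?_⟩
  set δ := min (a / (4 * M)) (min r₁ η / Γ) with hδ
  have hδ0 : 0 < δ := by positivity
  have hδΓ : δ * Γ ≤ min r₁ η := by
    rw [← le_div_iff₀ hΓ0]; exact min_le_right _ _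
  have hδa : δ ≤ a / (4 * M) := min_le_left _ _
  set H : Phase → Phase := fun x => F (clamp ρ' x) + G (clamp ρ' x) with hHdef
  have hGK : LipschitzWith ⟨δ, hδ0.le⟩ fun x => G (clamp ρ' x) :=
    LipschitzWith.of_dist_le_mul fun x y => by
      have h1 := hGl _ (hcl' x) _ (hcl' y)
      rw [← dist_eq_norm, ← dist_eq_norm] at h1
      exact h1.trans (mul_le_mul_of_nonneg_left (dist_clamp_le ρ' x y) hδ0.le)
  obtain ⟨y, hyT, hy⟩ := exists_global_solution (hFK.add hGK) (M := BF + δ)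
    (fun x => (norm_add_le _ _).trans (add_le_add (hBF _ (hcl x)) (hG _ (hcl' x)))) T x₀
  change ∀ t, HasDerivAt y (H (y t)) t at hy
  have hHeq : ∀ x : Phase, ‖x‖ ≤ ρ' → H x = F x + G x := fun x hx => by
    rw [hHdef]; simp only [clamp_eq_self hx]
  have hyc : Continuous y := continuous_iff_continuousAt.2 fun t => (hy t).continuousAt
  have hgron : ∀ t ∈ Set.Icc T T₁, ‖y t - γ t‖ ≤ min r₁ η := fun t ht => by
    have h1 := dist_le_of_approx_trajectories_ODE (v := fun _ x => F (clamp ρ' x)) (K := K + 1)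
      (f := y) (f' := fun t => H (y t)) (g := γ) (g' := fun t => F (γ t)) (a := T) (b := T₁)
      (δ := δ) (εf := δ) (εg := 0) (fun _ => hFK) hyc.continuousOn
      (fun t _ => (hy t).hasDerivWithinAt)
      (fun t _ => by
        rw [dist_eq_norm, hHdef, add_sub_cancel_left]
        exact hG _ (hcl' _))
      (hγc.mono Set.Icc_subset_Ici_self)
      (fun t ht => (hγ t ht.1).mono (Set.Ici_subset_Ici.2 ht.1))
      (fun t ht => by
        rw [clamp_eq_self ((hγR t ht.1).trans (by rw [hρ']; linarith)), dist_self])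
      (by rw [dist_eq_norm, hyT]; exact hx₀) t ht
    rw [dist_eq_norm, add_zero, gronwallBound_of_K_ne_0 hk0.ne'] at h1
    change ‖y t - γ t‖ ≤ δ * Real.exp (k * (t - T)) + δ / k * (Real.exp (k * (t - T)) - 1) at h1
    refine h1.trans (le_trans ?_ hδΓ)
    have hexp : Real.exp (k * (t - T)) ≤ Real.exp (k * (T₁ - T)) := by
      gcongr
      exact ht.2
    calc δ * Real.exp (k * (t - T)) + δ / k * (Real.exp (k * (t - T)) - 1)
        ≤ δ * Real.exp (k * (T₁ - T)) + δ / k * (Real.exp (k * (T₁ - T)) - 1) := by gcongr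
      _ = δ * Γ := by rw [hΓ]; ring
  have hyT₁ : ‖y T₁‖ ≤ 2 * r₁ := by
    have h1 := (hgron T₁ ⟨hTT₁, le_rfl⟩).trans (min_le_left _ _)
    have h2 := norm_add_le (y T₁ - γ T₁) (γ T₁)
    rw [sub_add_cancel] at h2
    linarith [hγr₁ T₁ le_rfl]
  have hrρ : r ≤ ρ' := by rw [hρ']; linarith
  have hdecay := hQ.le_exp_of_solution (H := H) hr0 (fun x hx => by
      rw [hHeq x (hx.le.trans hrρ)]
      have h1 := hFr x (hx.trans_le (min_le_left _ _))
      have hx' : x ∈ Metric.ball (0 : Phase) (R₀ + 2) := by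
        rw [mem_ball_zero_iff]; linarith
      have h2 := hGl x hx' 0 (Metric.mem_ball_self (by positivity))
      rw [hG0, sub_zero, sub_zero] at h2
      calc ‖F x + G x - fderiv ℝ F 0 x‖ = ‖(F x - fderiv ℝ F 0 x) + G x‖ := by congr 1; abel
        _ ≤ a / (4 * M) * ‖x‖ + δ * ‖x‖ := (norm_add_le _ _).trans (add_le_add h1 h2)
        _ ≤ a / (4 * M) * ‖x‖ + a / (4 * M) * ‖x‖ := by gcongr
        _ = a / (2 * M) * ‖x‖ := by field_simp; ring)
    (y := y) (T := T₁) (β := m * r ^ 2 / 2) (fun t _ => hy t) (by positivity)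
    (by have : 0 < m * r ^ 2 := by positivity
        linarith)
    (le_trans (by gcongr) hr₁β)
  have hsmall : ∀ t, T₁ ≤ t → ‖y t‖ < r := fun t ht => by
    have h1 := hdecay t ht
    have h2 : Real.exp (-(a / (4 * M)) * (t - T₁)) ≤ 1 := Real.exp_le_one_iff.2 (by
      have : 0 ≤ a / (4 * M) * (t - T₁) := mul_nonneg (by positivity) (by linarith)
      linarith)
    have h3 : 0 < m * r ^ 2 := by positivity
    have h4 : m * ‖y t‖ ^ 2 < m * r ^ 2 := by nlinarith
    exact lt_of_pow_lt_pow_left₀ 2 hr0.le (lt_of_mul_lt_mul_left h4 hm.le)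
  have hclose : ∀ t, T ≤ t → ‖y t - γ t‖ ≤ η := fun t ht => by
    rcases le_total t T₁ with h | h
    · exact (hgron t ⟨ht, h⟩).trans (min_le_right _ _)
    · have h1 := hsmall t h
      have h2 := hγr₁ t h
      have h3 := norm_sub_le (y t) (γ t)
      linarith
  refine ⟨y, hyT, fun t ht => ?_, ?_, fun t ht => (hclose t ht).trans (min_le_left _ _)⟩
  · have h1 := hclose t ht
    have h2 := hγR t ht
    have h3 := norm_add_le (y t - γ t) (γ t)
    rw [sub_add_cancel] at h3
    rw [← hHeq (y t) (by rw [hρ']; linarith)]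
    exact hy t
  · have h1 : Tendsto (fun t => r ^ 2 / 2 * Real.exp (-(a / (4 * M)) * (t - T₁))) atTop (𝓝 0) := by
      have h2 : Tendsto (fun t => -(a / (4 * M)) * (t - T₁)) atTop atBot :=
        (tendsto_atTop_add_const_right _ (-T₁) tendsto_id).const_mul_atTop_of_neg
          (neg_lt_zero.2 (by positivity))
      simpa using (Real.tendsto_exp_atBot.comp h2).const_mul (r ^ 2 / 2)
    have h2 : Tendsto (fun t => ‖y t‖ ^ 2) atTop (𝓝 0) := by
      refine tendsto_of_tendsto_of_tendsto_of_le_of_le' tendsto_const_nhds h1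
        (Eventually.of_forall fun t => by positivity) ?_
      filter_upwards [eventually_ge_atTop T₁] with t ht
      have h3 := hdecay t ht
      have h4 : m * ‖y t‖ ^ 2 ≤ m * (r ^ 2 / 2 * Real.exp (-(a / (4 * M)) * (t - T₁))) := by
        linarith
      exact le_of_mul_le_mul_left h4 hm
    have h3 := h2.sqrt
    simp only [Real.sqrt_sq (norm_nonneg _), Real.sqrt_zero] at h3
    exact tendsto_zero_iff_norm_tendsto_zero.2 h3

end Forward

/-! ### Gluing the two halves -/

section Persistence

/-- How small `ε` must be may depend on the tolerance `η`, while persistence asks for one family of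
orbits. For each `ε` an orbit is chosen whose tolerance exceeds the infimum of the attainable ones
by at most `ε`. -/
theorem persists_of_forall_eventually {f : ℝ → Phase → Phase} {γ : ℝ → Phase} {p : Phase}
    (h : ∀ η > 0, ∀ᶠ ε in 𝓝[>] (0 : ℝ), ∃ (q : Phase) (y : ℝ → Phase),
      IsHeteroclinic (f ε) y q 0 ∧ ‖q - p‖ ≤ η ∧ ∀ t, ‖y t - γ t‖ ≤ η) :
    Persists f γ p := by
  let A : ℝ → Set ℝ := fun ε => {η | 0 < η ∧ ∃ (q : Phase) (y : ℝ → Phase),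
      IsHeteroclinic (f ε) y q 0 ∧ ‖q - p‖ ≤ η ∧ ∀ t, ‖y t - γ t‖ ≤ η}
  have hbdd : ∀ ε, BddBelow (A ε) := fun ε => ⟨0, fun η hη => hη.1.le⟩
  obtain ⟨ε₀, hε₀, hne⟩ := mem_nhdsGT_iff_exists_Ioo_subset.1 (h 1 one_pos)
  have hsel : ∀ ε, ∃ (q : Phase) (y : ℝ → Phase), ε ∈ Set.Ioo 0 ε₀ →
      IsHeteroclinic (f ε) y q 0 ∧ ‖q - p‖ ≤ sInf (A ε) + ε ∧
        ∀ t, ‖y t - γ t‖ ≤ sInf (A ε) + ε := fun ε => by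
    by_cases hε : ε ∈ Set.Ioo 0 ε₀
    · have hA : (A ε).Nonempty := ⟨1, one_pos, hne hε⟩
      obtain ⟨η, ⟨-, q, y, h1, h2, h3⟩, hη⟩ := exists_lt_of_csInf_lt hA (lt_add_of_pos_right _ hε.1)
      exact ⟨q, y, fun _ => ⟨h1, h2.trans hη.le, fun t => (h3 t).trans hη.le⟩⟩
    · exact ⟨0, 0, fun h' => absurd h' hε⟩
  choose q y hqy using hsel
  have hsmall : ∀ η > 0, ∀ᶠ ε in 𝓝[>] (0 : ℝ), ε ∈ Set.Ioo 0 ε₀ ∧ sInf (A ε) + ε < η := by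
    intro η hη
    filter_upwards [h (η / 2) (by positivity), Ioo_mem_nhdsGT hε₀,
      Ioo_mem_nhdsGT (show (0 : ℝ) < η / 2 by positivity)] with ε h1 h2 h3
    have : sInf (A ε) ≤ η / 2 := csInf_le (hbdd ε) ⟨by positivity, h1⟩
    exact ⟨h2, by linarith [h3.2]⟩
  refine ⟨ε₀, hε₀, q, y, fun ε hε => (hqy ε hε).1, ?_, ?_⟩
  · rw [Metric.tendsto_nhds]
    intro η hη
    filter_upwards [hsmall η hη] with ε hε
    rw [dist_eq_norm]
    exact (hqy ε hε.1).2.1.trans_lt hε.2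
  · rw [Metric.tendstoUniformly_iff]
    intro η hη
    filter_upwards [hsmall η hη] with ε hε t
    rw [dist_comm, dist_eq_norm]
    exact ((hqy ε hε.1).2.2 t).trans_lt hε.2

theorem hasDerivAt_glue {V : Type*} [NormedAddCommGroup V] [NormedSpace ℝ V] {H : V → V}
    {y₁ y₂ : ℝ → V} {T : ℝ} (h₁ : ∀ t ≤ T, HasDerivAt y₁ (H (y₁ t)) t)
    (h₂ : ∀ t, T ≤ t → HasDerivAt y₂ (H (y₂ t)) t) (hT : y₂ T = y₁ T) (t : ℝ) :
    HasDerivAt (fun t => if t ≤ T then y₁ t else y₂ t) (H (if t ≤ T then y₁ t else y₂ t)) t := by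
  rcases lt_trichotomy t T with h | rfl | h
  · rw [if_pos h.le]
    refine (h₁ t h.le).congr_of_eventuallyEq ?_
    filter_upwards [Iio_mem_nhds h] with s hs
    rw [if_pos (le_of_lt hs)]
  · rw [if_pos le_rfl]
    have h3 : HasDerivWithinAt (fun s => if s ≤ t then y₁ s else y₂ s) (H (y₁ t)) (Set.Iic t) t :=
      (h₁ t le_rfl).hasDerivWithinAt.congr (fun s hs => if_pos hs) (if_pos le_rfl)
    have h4 : HasDerivWithinAt (fun s => if s ≤ t then y₁ s else y₂ s) (H (y₁ t)) (Set.Ici t) t := by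
      rw [← hT]
      refine (h₂ t le_rfl).hasDerivWithinAt.congr (fun s hs => ?_) (by rw [if_pos le_rfl, hT])
      rcases eq_or_lt_of_le (show t ≤ s from hs) with rfl | hs'
      · rw [if_pos le_rfl, hT]
      · rw [if_neg (not_le.2 hs')]
    have h5 := h3.union h4
    rwa [Set.Iic_union_Ici, hasDerivWithinAt_univ] at h5
  · rw [if_neg (not_le.2 h)]
    refine (h₂ t h.le).congr_of_eventuallyEq ?_
    filter_upwards [Ioi_mem_nhds h] with s hs
    rw [if_neg (not_le.2 hs)]

theorem IsOrderEps.exists_lipschitz {R : ℝ → Phase → (Fin 3 → ℝ)} (hR : IsOrderEps R) {ρ : ℝ}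
    (hρ : 0 < ρ) : ∃ C : ℝ, 0 ≤ C ∧ ∀ᶠ ε in 𝓝[>] (0 : ℝ),
      ContinuousOn (R ε) (Metric.ball 0 ρ) ∧
      (∀ x ∈ Metric.ball (0 : Phase) ρ, ‖R ε x‖ ≤ C * ε) ∧
      ∀ x ∈ Metric.ball (0 : Phase) ρ, ∀ y ∈ Metric.ball (0 : Phase) ρ,
        ‖R ε x - R ε y‖ ≤ C * ε * ‖x - y‖ := by
  obtain ⟨C, hC⟩ := hR.small_on_balls ρ hρ
  refine ⟨max C 0, le_max_right _ _, ?_⟩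
  filter_upwards [hC, self_mem_nhdsWithin] with ε hε hε0
  have hle : C * ε ≤ max C 0 * ε := mul_le_mul_of_nonneg_right (le_max_left _ _) (le_of_lt hε0)
  refine ⟨hε.1.continuousOn, fun x hx => (hε.2 x hx).1.trans hle, fun x hx y hy => ?_⟩
  exact (convex_ball (0 : Phase) ρ).norm_image_sub_le_of_norm_fderiv_le
    (fun z hz => (hε.1.differentiableOn one_ne_zero).differentiableAt (Metric.isOpen_ball.mem_nhds hz))
    (fun z hz => (hε.2 z hz).2.trans hle) hy hx

/-- The backward orbit ends at time `T` within `O(ε)` of `γ T`, and the forward lemma accepts every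
initial value that close. The glued curve is a solution through `T` because both one-sided
derivatives are given by the same field. -/
theorem persists_of_lyapunovForm {F : Phase → Phase} (hF : ContDiff ℝ 1 F) (hF0 : F 0 = 0)
    {Q : Phase → ℝ} {Q' : Phase → Phase → ℝ} {m M a : ℝ}
    (hQ : IsLyapunovForm (fderiv ℝ F 0) Q Q' m M a) {R : ℝ → Phase → (Fin 3 → ℝ)}
    (hR : IsOrderEps R) {p : Phase} {γ : ℝ → Phase} (hp : IsHyperbolicAt F p)
    (hγ : IsHeteroclinic F γ p 0) : Persists (fun ε x => F x + (0, R ε x)) γ p := by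
  obtain ⟨S, hS⟩ := exists_isRightInverse (fderiv ℝ F p) hp
  obtain ⟨T, r, C, κ₀, hr, hC, hκ₀, hback⟩ := exists_perturbed_backward_orbit
    (hF.contDiffAt.hasStrictFDerivAt one_ne_zero) hF.continuous hS hγ.solution hγ.tendsto_source
  obtain ⟨ρ₁, hρ₁, hforw⟩ := exists_perturbed_forward_orbit hF hF0 hQ (γ := γ) (T := T)
    (fun t _ => (hγ.solution t).hasDerivWithinAt) hγ.tendsto_target
  have hsub : Metric.ball p r ⊆ Metric.ball (0 : Phase) (ρ₁ + ‖p‖ + r) :=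
    Metric.ball_subset_ball' (by rw [dist_zero_right]; linarith)
  have hsub' : Metric.ball (0 : Phase) ρ₁ ⊆ Metric.ball (0 : Phase) (ρ₁ + ‖p‖ + r) :=
    Metric.ball_subset_ball (by linarith [norm_nonneg p])
  obtain ⟨c, hc, hRc⟩ := hR.exists_lipschitz (ρ := ρ₁ + ‖p‖ + r) (by positivity)
  have hp0 : 0 < ‖p‖ := norm_pos_iff.2 hγ.ne
  refine persists_of_forall_eventually fun η₀ hη₀ => ?_
  -- The second bound keeps the new equilibrium away from `0`, so that the orbit is heteroclinic.
  set η := min η₀ (‖p‖ / 2) with hη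
  have hη0 : 0 < η := by positivity
  obtain ⟨δ, hδ, hforw⟩ := hforw η hη0
  have hlim : ∀ b > 0, ∀ᶠ ε in 𝓝[>] (0 : ℝ), (C + 1) * (c * ε) < b := fun b hb => by
    have h1 : Tendsto (fun ε : ℝ => (C + 1) * (c * ε)) (𝓝 0) (𝓝 ((C + 1) * (c * 0))) :=
      (Continuous.tendsto (by fun_prop) 0)
    rw [mul_zero, mul_zero] at h1
    exact (h1.mono_left nhdsWithin_le_nhds).eventually_lt_const hb
  filter_upwards [hRc, hR.zero_at_trivial, hlim _ (lt_min (lt_min hκ₀ hδ) hη0),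
    self_mem_nhdsWithin] with ε hRε hR0 hsmall hε0
  have hε0' : (0 : ℝ) < ε := hε0
  obtain ⟨hRcont, hRb, hRl⟩ := hRε
  set κ := c * ε with hκ
  have hκ0 : 0 ≤ κ := by positivity
  have hκle : κ ≤ (C + 1) * κ := by nlinarith
  have hCκle : C * κ ≤ (C + 1) * κ := by nlinarith
  have hb1 := hsmall.le.trans ((min_le_left _ _).trans (min_le_left _ _))
  have hb2 := hsmall.le.trans ((min_le_left _ _).trans (min_le_right _ _))
  have hb3 := hsmall.le.trans (min_le_right _ _)
  let G : Phase → Phase := fun x => (0, R ε x)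
  have hGn : ∀ x, ‖G x‖ = ‖R ε x‖ := fun x => by simp [G, Prod.norm_def]
  have hGs : ∀ x y, ‖G x - G y‖ = ‖R ε x - R ε y‖ := fun x y => by simp [G, Prod.norm_def]
  obtain ⟨y₁, l, hy₁, hl, hlr, hcl₁⟩ := hback G κ hκ0 (hκle.trans hb1)
    (fun x hx => (hGn x).trans_le (hRb x (hsub hx)))
    (fun x hx y hy => (hGs x y).trans_le (hRl x (hsub hx) y (hsub hy)))
  obtain ⟨y₂, hy₂T, hy₂, hl₂, hcl₂⟩ := hforw G (by simp [G, hR0])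
    (fun x hx => (hGn x).trans_le ((hRb x (hsub' hx)).trans (hκle.trans hb2)))
    (fun x hx y hy => (hGs x y).trans_le ((hRl x (hsub' hx) y (hsub' hy)).trans
      (mul_le_mul_of_nonneg_right (hκle.trans hb2) (norm_nonneg _))))
    (y₁ T) ((hcl₁ T le_rfl).trans (hCκle.trans hb2))
  set z : ℝ → Phase := fun t => if t ≤ T then y₁ t else y₂ t with hz
  have hzl : Tendsto z atBot (𝓝 l) := hl.congr' <| by
    filter_upwards [eventually_le_atBot T] with t ht
    rw [hz]; simp only [if_pos ht]
  have hzr : Tendsto z atTop (𝓝 0) := hl₂.congr' <| by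
    filter_upwards [eventually_gt_atTop T] with t ht
    rw [hz]; simp only [if_neg (not_le.2 ht)]
  have hzc : ∀ t, ‖z t - γ t‖ ≤ η := fun t => by
    rcases le_or_gt t T with h | h
    · simp only [hz, if_pos h]
      exact (hcl₁ t h).trans (hCκle.trans hb3)
    · simp only [hz, if_neg (not_le.2 h)]
      exact hcl₂ t h.le
  have hlp : ‖l - p‖ ≤ η := le_of_tendsto (hzl.sub hγ.tendsto_source).norm (Eventually.of_forall hzc)
  have hRat : ContinuousAt (R ε) l := hRcont.continuousAt (Metric.isOpen_ball.mem_nhds (hsub hlr))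
  have hGc : ContinuousAt (fun x => F x + G x) l :=
    hF.continuous.continuousAt.add (continuousAt_const.prodMk hRat)
  refine ⟨l, z, ⟨?_, ?_, ?_, hasDerivAt_glue (H := fun x => F x + G x) hy₁ hy₂ hy₂T, hzl, hzr⟩,
    hlp.trans (min_le_left _ _), fun t => (hzc t).trans (min_le_left _ _)⟩
  · rintro rfl
    rw [zero_sub, norm_neg] at hlp
    linarith [hlp.trans (min_le_right _ _)]
  · exact eq_zero_of_tendsto_atBot (H := fun x => F x + G x) hy₁ hl hGc
  · simp [hF0, hR0]

theorem isOpen_stableManifold_of_lyapunovForm {F : Phase → Phase} (hF : ContDiff ℝ 1 F)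
    (hF0 : F 0 = 0) {Q : Phase → ℝ} {Q' : Phase → Phase → ℝ} {m M a : ℝ}
    (hQ : IsLyapunovForm (fderiv ℝ F 0) Q Q' m M a) : IsOpen (stableManifold F 0) := by
  rw [Metric.isOpen_iff]
  rintro x ⟨γ, rfl, hγ, hlim⟩
  obtain ⟨ρ, -, h⟩ := exists_perturbed_forward_orbit hF hF0 hQ (γ := γ) (T := 0) hγ hlim
  obtain ⟨δ, hδ, h⟩ := h 1 one_pos
  refine ⟨δ, hδ, fun x hx => ?_⟩
  rw [Metric.mem_ball, dist_eq_norm] at hx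
  obtain ⟨y, hy0, hy, hyl, -⟩ := h (fun _ => 0) rfl (fun _ _ => by simpa using hδ.le)
    (fun x _ y _ => by
      rw [sub_zero, norm_zero]
      positivity) x hx.le
  refine ⟨y, hy0, fun t ht => ?_, hyl⟩
  have := hy t ht
  rw [add_zero] at this
  exact this.hasDerivWithinAt

end Persistence

/-! ### The leading-order system: Lyapunov function and hyperbolicity criterion -/

section LeadingOrder

theorem diffusion_pos {θ : ℝ} (hθ : θ ∈ Set.Ioo 0 (Real.pi / 6)) (j : Fin 3) :
    0 < diffusion θ j := by
  have h3 : (0 : ℝ) ≤ √3 := Real.sqrt_nonneg _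
  have hpi := Real.pi_pos
  -- The products `d · k_j` are `cos θ`, `-cos (θ + π / 3)` and `-cos (θ - π / 3)`; the second is
  -- nonzero because `θ < π / 6`.
  have h0 : 0 < Real.cos θ := Real.cos_pos_of_mem_Ioo ⟨by linarith [hθ.1], by linarith [hθ.2]⟩
  have h1 : 0 < Real.cos (θ + Real.pi / 3) :=
    Real.cos_pos_of_mem_Ioo ⟨by linarith [hθ.1], by linarith [hθ.2]⟩
  have h2 : 0 < Real.cos (θ - Real.pi / 3) :=
    Real.cos_pos_of_mem_Ioo ⟨by linarith [hθ.1], by linarith [hθ.2]⟩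
  rw [Real.cos_add, Real.cos_pi_div_three, Real.sin_pi_div_three] at h1
  rw [Real.cos_sub, Real.cos_pi_div_three, Real.sin_pi_div_three] at h2
  have key : direction θ ⬝ᵥ waveVector j ≠ 0 := by
    fin_cases j <;> simp [direction, waveVector, dotProduct, Fin.sum_univ_two]
    · exact h0.ne'
    · intro h; linarith
    · intro h; linarith
  unfold diffusion
  positivity

variable (θ μ₀ c₀ β₂ K₀ K₂ : ℝ)

/-- The derivative at the amplitudes `A`, in direction `u`, of the reaction terms. -/
def reactionDeriv (A u : Fin 3 → ℝ) (j : Fin 3) : ℝ :=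
  μ₀ * u j + β₂ * (u (j + 1) * A (j + 2) + A (j + 1) * u (j + 2))
    + (2 * K₀ * A j * u j + 2 * K₂ * (A (j + 1) * u (j + 1) + A (j + 2) * u (j + 2))) * A j
    + (K₀ * A j ^ 2 + K₂ * (A (j + 1) ^ 2 + A (j + 2) ^ 2)) * u j

theorem contDiff_leadingField : ContDiff ℝ 1 (leadingField θ μ₀ c₀ β₂ K₀ K₂) := by
  unfold leadingField
  fun_prop

theorem leadingField_zero : leadingField θ μ₀ c₀ β₂ K₀ K₂ 0 = 0 := by
  refine Prod.ext rfl (funext fun j => ?_)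
  simp [leadingField]

theorem fderiv_leadingField (x v : Phase) :
    fderiv ℝ (leadingField θ μ₀ c₀ β₂ K₀ K₂) x v =
      (v.2, fun j => -(1 / diffusion θ j) *
        (reactionDeriv μ₀ β₂ K₀ K₂ x.1 v.1 j + c₀ * v.2 j)) := by
  have h1 : HasDerivAt (fun t : ℝ => x + t • v) v 0 := by
    simpa using ((hasDerivAt_id (0 : ℝ)).smul_const v).const_add x
  have h2 := (((contDiff_leadingField θ μ₀ c₀ β₂ K₀ K₂).differentiable
    one_ne_zero).differentiableAt (x := x + (0 : ℝ) • v)).hasFDerivAt.comp_hasDerivAt 0 h1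
  rw [zero_smul, add_zero] at h2
  refine h2.unique ?_
  have h3 : ∀ i, HasDerivAt (fun t : ℝ => (x + t • v).1 i) (v.1 i) 0 := fun i =>
    hasDerivAt_pi.1 h1.fst i
  have h4 : ∀ i, HasDerivAt (fun t : ℝ => (x + t • v).2 i) (v.2 i) 0 := fun i =>
    hasDerivAt_pi.1 h1.snd i
  refine HasDerivAt.prodMk h1.snd (hasDerivAt_pi.2 fun j => ?_)
  have h5 := (((h3 j).const_mul (-(μ₀ / diffusion θ j))).sub
    ((h4 j).const_mul (c₀ / diffusion θ j))).sub
    (((((h3 (j + 1)).mul (h3 (j + 2))).const_mul β₂).add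
      (((((h3 j).pow 2).const_mul K₀).add
        ((((h3 (j + 1)).pow 2).add ((h3 (j + 2)).pow 2)).const_mul K₂)).mul (h3 j))).const_mul
          (1 / diffusion θ j))
  convert h5 using 1
  · rfl
  · simp [reactionDeriv]
    ring

/-- A Lyapunov function of the damped linear oscillators `D A'' + c₀ A' + μ₀ A = 0`. -/
noncomputable def oscillatorForm (x : Phase) : ℝ :=
  ∑ j, (μ₀ * x.1 j ^ 2 + diffusion θ j * x.2 j ^ 2 + c₀ * (x.1 j * x.2 j)
    + c₀ ^ 2 / (2 * diffusion θ j) * x.1 j ^ 2)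

/-- The derivative of `oscillatorForm` at `x` in direction `v`. -/
noncomputable def oscillatorFormDeriv (x v : Phase) : ℝ :=
  ∑ j, (2 * μ₀ * (x.1 j * v.1 j) + 2 * diffusion θ j * (x.2 j * v.2 j)
    + c₀ * (x.1 j * v.2 j + x.2 j * v.1 j) + c₀ ^ 2 / diffusion θ j * (x.1 j * v.1 j))

theorem norm_sq_le_sum (x : Phase) : ‖x‖ ^ 2 ≤ ∑ j, (x.1 j ^ 2 + x.2 j ^ 2) := by
  set N := ∑ j, (x.1 j ^ 2 + x.2 j ^ 2)
  have hN : 0 ≤ N := Finset.sum_nonneg fun j _ => by positivity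
  have hj : ∀ j, x.1 j ^ 2 + x.2 j ^ 2 ≤ N := fun j =>
    Finset.single_le_sum (f := fun j => x.1 j ^ 2 + x.2 j ^ 2) (fun j _ => by positivity)
      (Finset.mem_univ j)
  have h : ‖x‖ ≤ √N := by
    rw [Prod.norm_def]
    refine max_le ((pi_norm_le_iff_of_nonneg (Real.sqrt_nonneg _)).2 fun j => ?_)
      ((pi_norm_le_iff_of_nonneg (Real.sqrt_nonneg _)).2 fun j => ?_) <;>
    · rw [Real.norm_eq_abs]
      exact Real.abs_le_sqrt (by nlinarith [hj j, sq_nonneg (x.1 j), sq_nonneg (x.2 j)])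
  calc ‖x‖ ^ 2 ≤ √N ^ 2 := by gcongr
    _ = N := Real.sq_sqrt hN

variable {θ μ₀ c₀}

/-- The energy `μ₀ A² + D B²` decays only through `B`. The added terms `c₀ A B + c₀² A² / (2 D)`
make the derivative equal to `-(c₀ B² + c₀ μ₀ A² / D)`, with no mixed term. Positivity follows by
completing the square: these terms and half of `D B²` add up to `(D B + c₀ A)² / (2 D)`. -/
theorem exists_isLyapunovForm (hθ : θ ∈ Set.Ioo 0 (Real.pi / 6)) (hμ₀ : 0 < μ₀) (hc₀ : 0 < c₀) :
    ∃ m M a : ℝ, IsLyapunovForm (fderiv ℝ (leadingField θ μ₀ c₀ β₂ K₀ K₂) 0)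
      (oscillatorForm θ μ₀ c₀) (oscillatorFormDeriv θ μ₀ c₀) m M a := by
  have hD := diffusion_pos hθ
  set D := diffusion θ with hDdef
  obtain ⟨d, hd, hdD⟩ : ∃ d > 0, ∀ j, d ≤ D j := by
    obtain ⟨i, hi⟩ := Finite.exists_min D
    exact ⟨D i, hD i, hi⟩
  obtain ⟨e, he, heD⟩ : ∃ e > 0, ∀ j, D j ≤ e := by
    obtain ⟨i, hi⟩ := Finite.exists_max D
    exact ⟨D i, hD i, hi⟩
  set m := min μ₀ (d / 2) with hm
  set M := 3 * (2 * μ₀ + 2 * e + 2 * c₀ + c₀ ^ 2 / d) with hM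
  set a := min c₀ (c₀ * μ₀ / e) with ha
  have hm0 : 0 < m := by positivity
  have ha0 : 0 < a := by positivity
  have hM0 : 0 < M := by positivity
  have hbound : ∀ x v, oscillatorFormDeriv θ μ₀ c₀ x v ≤ M * ‖x‖ * ‖v‖ := fun x v => by
    have hmul : ∀ {a b : ℝ}, |a| ≤ ‖x‖ → |b| ≤ ‖v‖ → a * b ≤ ‖x‖ * ‖v‖ := fun {a b} h1 h2 =>
      (le_abs_self _).trans (by rw [abs_mul]; gcongr)
    have hx1 : ∀ j, |x.1 j| ≤ ‖x‖ := fun j => (norm_le_pi_norm x.1 j).trans (norm_fst_le x)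
    have hx2 : ∀ j, |x.2 j| ≤ ‖x‖ := fun j => (norm_le_pi_norm x.2 j).trans (norm_snd_le x)
    have hv1 : ∀ j, |v.1 j| ≤ ‖v‖ := fun j => (norm_le_pi_norm v.1 j).trans (norm_fst_le v)
    have hv2 : ∀ j, |v.2 j| ≤ ‖v‖ := fun j => (norm_le_pi_norm v.2 j).trans (norm_snd_le v)
    have hterm : ∀ j ∈ Finset.univ, 2 * μ₀ * (x.1 j * v.1 j) + 2 * D j * (x.2 j * v.2 j)
        + c₀ * (x.1 j * v.2 j + x.2 j * v.1 j) + c₀ ^ 2 / D j * (x.1 j * v.1 j)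
        ≤ (2 * μ₀ + 2 * e + 2 * c₀ + c₀ ^ 2 / d) * (‖x‖ * ‖v‖) := fun j _ => by
      have hDj := hD j
      have e1 : 2 * μ₀ * (x.1 j * v.1 j) ≤ 2 * μ₀ * (‖x‖ * ‖v‖) := by
        exact mul_le_mul_of_nonneg_left (hmul (hx1 j) (hv1 j)) (by positivity)
      have e2 : 2 * D j * (x.2 j * v.2 j) ≤ 2 * e * (‖x‖ * ‖v‖) :=
        (mul_le_mul_of_nonneg_left (hmul (hx2 j) (hv2 j)) (by positivity)).trans
          (by gcongr; exact heD j)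
      have e3 : c₀ * (x.1 j * v.2 j + x.2 j * v.1 j) ≤ c₀ * (‖x‖ * ‖v‖ + ‖x‖ * ‖v‖) := by
        exact mul_le_mul_of_nonneg_left (add_le_add (hmul (hx1 j) (hv2 j)) (hmul (hx2 j) (hv1 j)))
          hc₀.le
      have e4 : c₀ ^ 2 / D j * (x.1 j * v.1 j) ≤ c₀ ^ 2 / d * (‖x‖ * ‖v‖) :=
        (mul_le_mul_of_nonneg_left (hmul (hx1 j) (hv1 j)) (by positivity)).trans
          (by gcongr; exact hdD j)
      linarith
    refine (Finset.sum_le_sum hterm).trans_eq ?_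
    rw [Finset.sum_const, Finset.card_univ, Fintype.card_fin, hM]
    simp only [nsmul_eq_mul]
    push_cast
    ring
  refine ⟨m, M, a, hm0, hM0, ha0, fun x => ?_, fun x => ?_, fun y v t s hy => ?_,
    fun x v w => ?_, hbound, fun x => ?_⟩
  · refine (mul_le_mul_of_nonneg_left (norm_sq_le_sum x) hm0.le).trans ?_
    rw [Finset.mul_sum]
    refine Finset.sum_le_sum fun j _ => ?_
    have hDj := hD j
    have h1 : m * x.1 j ^ 2 ≤ μ₀ * x.1 j ^ 2 := by gcongr; exact min_le_left _ _
    have h2 : m * x.2 j ^ 2 ≤ D j / 2 * x.2 j ^ 2 := by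
      gcongr
      exact (min_le_right _ _).trans (by linarith [hdD j])
    have h3 : D j / 2 * x.2 j ^ 2 + c₀ * (x.1 j * x.2 j) + c₀ ^ 2 / (2 * D j) * x.1 j ^ 2
        = (D j * x.2 j + c₀ * x.1 j) ^ 2 / (2 * D j) := by field_simp; ring
    have h4 : 0 ≤ (D j * x.2 j + c₀ * x.1 j) ^ 2 / (2 * D j) := by positivity
    rw [← hDdef]
    linarith
  -- Euler's identity for a quadratic form derives the upper bound from the bound on the derivative.
  · have h1 : oscillatorFormDeriv θ μ₀ c₀ x x = 2 * oscillatorForm θ μ₀ c₀ x := by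
      simp only [oscillatorFormDeriv, oscillatorForm, Finset.mul_sum]
      refine Finset.sum_congr rfl fun j _ => ?_
      have := (hD j).ne'
      rw [← hDdef]
      field_simp
      ring
    have h2 := hbound x x
    have h3 : 0 ≤ M * ‖x‖ ^ 2 := by positivity
    nlinarith
  · have h1 : ∀ j, HasDerivWithinAt (fun τ => (y τ).1 j) (v.1 j) s t := fun j =>
      hasDerivWithinAt_pi.1 hy.fst j
    have h2 : ∀ j, HasDerivWithinAt (fun τ => (y τ).2 j) (v.2 j) s t := fun j =>
      hasDerivWithinAt_pi.1 hy.snd j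
    refine HasDerivWithinAt.fun_sum fun j _ => ?_
    have h3 := ((((h1 j).pow 2).const_mul μ₀).add (((h2 j).pow 2).const_mul (D j))).add
      (((h1 j).mul (h2 j)).const_mul c₀) |>.add
      (((h1 j).pow 2).const_mul (c₀ ^ 2 / (2 * D j)))
    convert h3 using 1
    · rfl
    · have := (hD j).ne'
      simp [← hDdef]
      field_simp
      ring
  · simp only [oscillatorFormDeriv, ← Finset.sum_add_distrib]
    refine Finset.sum_congr rfl fun j _ => ?_
    simp only [Prod.fst_add, Prod.snd_add, Pi.add_apply]
    ring
  · have h1 : ∀ j ∈ Finset.univ, (2 * μ₀ * (x.1 j * x.2 j)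
        + 2 * D j * (x.2 j * (-(1 / D j) * (μ₀ * x.1 j + c₀ * x.2 j)))
        + c₀ * (x.1 j * (-(1 / D j) * (μ₀ * x.1 j + c₀ * x.2 j)) + x.2 j * x.2 j)
        + c₀ ^ 2 / D j * (x.1 j * x.2 j)) ≤ -a * (x.1 j ^ 2 + x.2 j ^ 2) := fun j _ => by
      have hDj := hD j
      have h2 : 2 * μ₀ * (x.1 j * x.2 j)
        + 2 * D j * (x.2 j * (-(1 / D j) * (μ₀ * x.1 j + c₀ * x.2 j)))
        + c₀ * (x.1 j * (-(1 / D j) * (μ₀ * x.1 j + c₀ * x.2 j)) + x.2 j * x.2 j)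
        + c₀ ^ 2 / D j * (x.1 j * x.2 j) = -(c₀ * x.2 j ^ 2 + c₀ * μ₀ / D j * x.1 j ^ 2) := by
        field_simp
        ring
      have h3 : a * x.2 j ^ 2 ≤ c₀ * x.2 j ^ 2 := by gcongr; exact min_le_left _ _
      have h4 : a * x.1 j ^ 2 ≤ c₀ * μ₀ / D j * x.1 j ^ 2 := by
        gcongr
        refine (min_le_right _ _).trans ?_
        gcongr
        exact heD j
      rw [h2]
      linarith
    have h5 : oscillatorFormDeriv θ μ₀ c₀ x (fderiv ℝ (leadingField θ μ₀ c₀ β₂ K₀ K₂) 0 x)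
        ≤ ∑ j, -a * (x.1 j ^ 2 + x.2 j ^ 2) := by
      refine le_trans (le_of_eq ?_) (Finset.sum_le_sum h1)
      rw [fderiv_leadingField]
      refine Finset.sum_congr rfl fun j _ => ?_
      simp [reactionDeriv, ← hDdef]
    refine h5.trans ?_
    rw [← Finset.mul_sum]
    have := norm_sq_le_sum x
    nlinarith

/-- Let `u + i v` be an eigenvector to `i ω`. Pairing the equation for `u` with `v` and that for `v`
with `u`, the symmetric reaction and diffusion terms cancel, and `c₀ ω (|u|² + |v|²) = 0` remains
for the amplitude parts. These do not both vanish, so `ω = 0`, and both lie in the kernel of the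
linearised reaction terms. -/
theorem isHyperbolicAt_of_reactionDeriv_injective (hθ : θ ∈ Set.Ioo 0 (Real.pi / 6))
    (hc₀ : 0 < c₀) {A : Fin 3 → ℝ}
    (hA : ∀ u, (∀ j, reactionDeriv μ₀ β₂ K₀ K₂ A u j = 0) → u = 0) :
    IsHyperbolicAt (leadingField θ μ₀ c₀ β₂ K₀ K₂) (A, 0) := by
  intro z hz hre
  have hD := diffusion_pos hθ
  obtain ⟨u, v, huv, hu, hv⟩ := exists_pair_of_aeval_charpoly_eq_zero _ hz hre
  rw [fderiv_leadingField] at hu hv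
  set ω := z.im
  have hu2 : u.2 = -ω • v.1 := congrArg Prod.fst hu
  have hv2 : v.2 = ω • u.1 := congrArg Prod.fst hv
  have hu1 : ∀ j, reactionDeriv μ₀ β₂ K₀ K₂ A u.1 j
      = c₀ * ω * v.1 j + ω ^ 2 * diffusion θ j * u.1 j := fun j => by
    have h1 := congrFun (congrArg Prod.snd hu) j
    have h2 := (hD j).ne'
    simp [hu2, hv2] at h1
    field_simp at h1
    linarith
  have hv1 : ∀ j, reactionDeriv μ₀ β₂ K₀ K₂ A v.1 j
      = -(c₀ * ω * u.1 j) + ω ^ 2 * diffusion θ j * v.1 j := fun j => by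
    have h1 := congrFun (congrArg Prod.snd hv) j
    have h2 := (hD j).ne'
    simp [hu2, hv2] at h1
    field_simp at h1
    linarith
  have hsymm : ∑ j, reactionDeriv μ₀ β₂ K₀ K₂ A u.1 j * v.1 j
      = ∑ j, reactionDeriv μ₀ β₂ K₀ K₂ A v.1 j * u.1 j := by
    simp only [Fin.sum_univ_three, reactionDeriv, Fin.isValue, zero_add,
      show (1 : Fin 3) + 1 = 2 from rfl, show (1 : Fin 3) + 2 = 0 from rfl,
      show (2 : Fin 3) + 1 = 0 from rfl, show (2 : Fin 3) + 2 = 1 from rfl]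
    ring
  have hω : c₀ * ω * ∑ j, (u.1 j ^ 2 + v.1 j ^ 2) = 0 := by
    simp only [hu1, hv1, Fin.sum_univ_three] at hsymm ⊢
    linarith
  have hzero : u.1 = 0 → v.1 = 0 → False := fun h1 h2 => by
    rw [h2, smul_zero] at hu2
    rw [h1, smul_zero] at hv2
    rcases huv with h | h
    · exact h (Prod.ext h1 hu2)
    · exact h (Prod.ext h2 hv2)
  rcases mul_eq_zero.1 hω with h | h
  · have hω0 : ω = 0 := (mul_eq_zero.1 h).resolve_left hc₀.ne'
    exact hzero (hA _ fun j => by rw [hu1, hω0]; ring) (hA _ fun j => by rw [hv1, hω0]; ring)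
  · have h1 := (Finset.sum_eq_zero_iff_of_nonneg fun j _ => by positivity).1 h
    have h2 : ∀ j, u.1 j = 0 ∧ v.1 j = 0 := fun j => by
      have h3 := h1 j (Finset.mem_univ j)
      constructor <;> nlinarith [sq_nonneg (u.1 j), sq_nonneg (v.1 j)]
    exact hzero (funext fun j => (h2 j).1) (funext fun j => (h2 j).2)

/-- By symmetry the linearisation acts as a scalar on multiples of `(1, 1, 1)` and on vectors with
sum zero. After use of the equilibrium equation the scalars are `a (β₂ + 2 (K₀ + 2 K₂) a)` and `2 a
((K₀ - K₂) a - β₂)`. -/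
theorem reactionDeriv_hexagon_injective {a : ℝ} (ha : a ≠ 0)
    (heq : μ₀ + β₂ * a + (K₀ + 2 * K₂) * a ^ 2 = 0) (h1 : β₂ + 2 * (K₀ + 2 * K₂) * a ≠ 0)
    (h2 : (K₀ - K₂) * a ≠ β₂) (u : Fin 3 → ℝ)
    (hu : ∀ j, reactionDeriv μ₀ β₂ K₀ K₂ (fun _ => a) u j = 0) : u = 0 := by
  have hu0 := hu 0
  have hu1 := hu 1
  have hu2 := hu 2
  simp only [reactionDeriv, Fin.isValue, zero_add,
      show (1 : Fin 3) + 1 = 2 from rfl, show (1 : Fin 3) + 2 = 0 from rfl,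
      show (2 : Fin 3) + 1 = 0 from rfl, show (2 : Fin 3) + 2 = 1 from rfl] at hu0 hu1 hu2
  have hs : u 0 + u 1 + u 2 = 0 := by
    have : a * (β₂ + 2 * (K₀ + 2 * K₂) * a) * (u 0 + u 1 + u 2) = 0 := by
      linear_combination hu0 + hu1 + hu2 - (u 0 + u 1 + u 2) * heq
    exact (mul_eq_zero.1 this).resolve_left (mul_ne_zero ha h1)
  have hne : 2 * a * ((K₀ - K₂) * a - β₂) ≠ 0 :=
    mul_ne_zero (mul_ne_zero two_ne_zero ha) (sub_ne_zero.2 h2)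
  have key : ∀ i, 2 * a * ((K₀ - K₂) * a - β₂) * u i = 0 → u i = 0 := fun i h =>
    (mul_eq_zero.1 h).resolve_left hne
  have e0 : u 0 = 0 := key 0 (by
    linear_combination hu0 - u 0 * heq - (β₂ * a + 2 * K₂ * a ^ 2) * hs)
  have e1 : u 1 = 0 := key 1 (by
    linear_combination hu1 - u 1 * heq - (β₂ * a + 2 * K₂ * a ^ 2) * hs)
  have e2 : u 2 = 0 := key 2 (by
    linear_combination hu2 - u 2 * heq - (β₂ * a + 2 * K₂ * a ^ 2) * hs)
  ext i
  fin_cases i <;> assumption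

/-- The first component decouples with factor `-2 μ₀`. The other two form a symmetric block with
diagonal `μ₀ + K₂ s²` and off-diagonal `β₂ s`; the hypothesis `h` says that its determinant is
nonzero. -/
theorem reactionDeriv_roll_injective {s : ℝ} (hμ₀ : μ₀ ≠ 0) (hs : μ₀ + K₀ * s ^ 2 = 0)
    (h : (μ₀ + K₂ * s ^ 2) ^ 2 ≠ (β₂ * s) ^ 2) (u : Fin 3 → ℝ)
    (hu : ∀ j, reactionDeriv μ₀ β₂ K₀ K₂ ![s, 0, 0] u j = 0) : u = 0 := by
  have hu0 := hu 0
  have hu1 := hu 1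
  have hu2 := hu 2
  simp [reactionDeriv, Fin.isValue, zero_add,
      show (1 : Fin 3) + 1 = 2 from rfl, show (1 : Fin 3) + 2 = 0 from rfl,
      show (2 : Fin 3) + 1 = 0 from rfl, show (2 : Fin 3) + 2 = 1 from rfl] at hu0 hu1 hu2
  have e0 : u 0 = 0 := by
    have : μ₀ * u 0 = 0 := by linear_combination -(1 / 2) * hu0 + 3 / 2 * u 0 * hs
    exact (mul_eq_zero.1 this).resolve_left hμ₀
  have hne : (μ₀ + K₂ * s ^ 2) ^ 2 - (β₂ * s) ^ 2 ≠ 0 := sub_ne_zero.2 h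
  have key : ∀ i, ((μ₀ + K₂ * s ^ 2) ^ 2 - (β₂ * s) ^ 2) * u i = 0 → u i = 0 := fun i h =>
    (mul_eq_zero.1 h).resolve_left hne
  have e1 : u 1 = 0 := key 1 (by
    linear_combination (μ₀ + K₂ * s ^ 2) * hu1 - β₂ * s * hu2)
  have e2 : u 2 = 0 := key 2 (by
    linear_combination (μ₀ + K₂ * s ^ 2) * hu2 - β₂ * s * hu1)
  ext i
  fin_cases i <;> assumption

end LeadingOrder

/-! ### Nondegeneracy of down-hexagons and roll waves -/

section Equilibria

/-- These bounds place `muOne` between the degeneracy values of the two patterns: `-β₂² K₀ / (K₀ -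
K₂)²` for roll waves, which is at most `muOne`, and `-β₂² (2 K₀ + K₂) / (K₀ - K₂)²` for
down-hexagons, which is at least `muOne`. With `k = -K₀` and `l = -K₂` the denominator is `2 (σ -
q)`; multiplication by `σ + q` removes the root in `hdiff`, and only the elementary bounds `hlow`
and `hup` on `σ` are left. -/
theorem muOne_denominator_bounds {K₀ K₂ : ℝ} (hK₀ : K₀ < 0) (hK₂ : K₂ < 0) (h : K₀ < K₂) :
    0 < 2 * √2 * √(K₀ * (K₀ + K₂) ^ 3) - 2 * K₀ * (K₀ + 3 * K₂) ∧
    2 * √2 * √(K₀ * (K₀ + K₂) ^ 3) - 2 * K₀ * (K₀ + 3 * K₂) ≤ (K₀ - K₂) ^ 2 ∧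
    -K₀ * (K₀ - K₂) ^ 2 ≤ (2 * √2 * √(K₀ * (K₀ + K₂) ^ 3) - 2 * K₀ * (K₀ + 3 * K₂))
      * -(2 * K₀ + K₂) := by
  obtain ⟨k, rfl⟩ : ∃ k, K₀ = -k := ⟨-K₀, by ring⟩
  obtain ⟨l, rfl⟩ : ∃ l, K₂ = -l := ⟨-K₂, by ring⟩
  have hk : 0 < k := by linarith
  have hl : 0 < l := by linarith
  have hlk : 0 < k - l := by linarith
  have hrad : -k * (-k + -l) ^ 3 = k * (k + l) ^ 3 := by ring
  rw [hrad]
  set σ := √2 * √(k * (k + l) ^ 3) with hσ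
  have hσ0 : 0 < σ := by positivity
  have hσ2 : σ ^ 2 = 2 * (k * (k + l) ^ 3) := by
    rw [hσ, mul_pow, Real.sq_sqrt (by norm_num), Real.sq_sqrt (by positivity)]
  set q := k * (k + 3 * l) with hq
  have hq0 : 0 < q := by positivity
  have hdiff : (σ - q) * (σ + q) = k * (k - l) ^ 2 * (k + 2 * l) := by
    have : (σ - q) * (σ + q) = σ ^ 2 - q ^ 2 := by ring
    rw [this, hσ2, hq]
    ring
  have hsum : 0 < σ + q := by positivity
  have hpos : 0 < σ - q := pos_of_mul_pos_left (by rw [hdiff]; positivity) hsum.le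
  have hlow : k * (k + l) ≤ σ := by
    refine (sq_le_sq₀ (by positivity) hσ0.le).1 ?_
    rw [hσ2]
    have : 0 ≤ k * (k + l) ^ 2 * (k + 2 * l) := by positivity
    linarith
  have hup : σ ≤ 3 * k ^ 2 + 7 * (k * l) + 4 * l ^ 2 := by
    refine (sq_le_sq₀ hσ0.le (by positivity)).1 ?_
    rw [hσ2]
    have : 0 ≤ 7 * k ^ 4 + 36 * k ^ 3 * l + 67 * k ^ 2 * l ^ 2 + 54 * k * l ^ 3 + 16 * l ^ 4 := by
      positivity
    linarith
  have hden : 2 * √2 * √(k * (k + l) ^ 3) - 2 * -k * (-k + 3 * -l) = 2 * (σ - q) := by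
    rw [hσ, hq]; ring
  rw [hden]
  have hsq : (0 : ℝ) ≤ k * (k - l) ^ 2 := by positivity
  refine ⟨by linarith, ?_, ?_⟩
  · refine le_of_mul_le_mul_right ?_ hsum
    calc 2 * (σ - q) * (σ + q) = (k - l) ^ 2 * (2 * (k * (k + 2 * l))) := by
          rw [mul_assoc, hdiff]; ring
      _ ≤ (k - l) ^ 2 * (σ + q) := by
          gcongr
          rw [hq]
          linarith
      _ = (-k - -l) ^ 2 * (σ + q) := by ring
  · refine le_of_mul_le_mul_right ?_ hsum
    calc - -k * (-k - -l) ^ 2 * (σ + q) = k * (k - l) ^ 2 * (σ + q) := by ring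
      _ ≤ k * (k - l) ^ 2 * (2 * (k + 2 * l) * (2 * k + l)) := by
          gcongr
          rw [hq]
          linarith
      _ = 2 * ((σ - q) * (σ + q)) * (2 * k + l) := by rw [hdiff]; ring
      _ = 2 * (σ - q) * -(2 * -k + -l) * (σ + q) := by ring

variable {θ μ₀ c₀ β₂ K₀ K₂ : ℝ}

theorem isHyperbolicAt_downHexagon (hθ : θ ∈ Set.Ioo 0 (Real.pi / 6)) (hμ₀ : 0 < μ₀)
    (hc₀ : 0 < c₀) (hβ₂ : 0 ≤ β₂) (hK₀ : K₀ < 0) (hK₂ : K₂ < 0)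
    (h : K₂ < K₀ ∨ (K₀ < K₂ ∧ μ₀ < muOne β₂ K₀ K₂)) :
    IsHyperbolicAt (leadingField θ μ₀ c₀ β₂ K₀ K₂) (downHexagon μ₀ β₂ K₀ K₂) := by
  have hκ : K₀ + 2 * K₂ < 0 := by linarith
  have hΔ : β₂ ^ 2 < β₂ ^ 2 - 4 * μ₀ * (K₀ + 2 * K₂) := by nlinarith
  set s := √(β₂ ^ 2 - 4 * μ₀ * (K₀ + 2 * K₂)) with hs
  have hs2 : s ^ 2 = β₂ ^ 2 - 4 * μ₀ * (K₀ + 2 * K₂) :=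
    Real.sq_sqrt ((sq_nonneg β₂).trans hΔ.le)
  have hsβ : β₂ < s := Real.lt_sqrt_of_sq_lt hΔ
  set a := (-β₂ + s) / (2 * (K₀ + 2 * K₂)) with ha
  have h2κa : 2 * (K₀ + 2 * K₂) * a = -β₂ + s := by
    rw [ha]
    exact mul_div_cancel₀ _ (by linarith)
  have ha0 : a < 0 := div_neg_of_pos_of_neg (by linarith) (by linarith)
  have heq : μ₀ + β₂ * a + (K₀ + 2 * K₂) * a ^ 2 = 0 := by
    have : (4 * (K₀ + 2 * K₂)) * (μ₀ + β₂ * a + (K₀ + 2 * K₂) * a ^ 2) = 0 := by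
      linear_combination hs2 + (2 * (K₀ + 2 * K₂) * a + β₂ + s) * h2κa
    exact (mul_eq_zero.1 this).resolve_left (by linarith)
  refine isHyperbolicAt_of_reactionDeriv_injective β₂ K₀ K₂ hθ hc₀ (A := fun _ => a)
    (reactionDeriv_hexagon_injective β₂ K₀ K₂ ha0.ne heq (by rw [h2κa]; linarith) ?_)
  rcases h with h | ⟨h, hμ⟩
  -- Here `(K₀ - K₂) a` is negative while `β₂ ≥ 0`.
  · nlinarith [mul_pos (sub_pos.2 h) (neg_pos.2 ha0)]
  · intro hβ
    obtain ⟨hpos, -, hle⟩ := muOne_denominator_bounds hK₀ hK₂ h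
    rw [muOne, lt_div_iff₀ hpos] at hμ
    set den := 2 * √2 * √(K₀ * (K₀ + K₂) ^ 3) - 2 * K₀ * (K₀ + 3 * K₂)
    -- Degeneracy `β₂ = (K₀ - K₂) a` inserted into the equilibrium equation fixes `μ₀`, at a value
    -- not below `muOne`.
    have hμa : μ₀ = a ^ 2 * -(2 * K₀ + K₂) := by
      rw [← hβ] at heq
      linear_combination heq
    have h1 : a ^ 2 * (-K₀ * (K₀ - K₂) ^ 2) ≤ a ^ 2 * (den * -(2 * K₀ + K₂)) := by gcongr
    rw [hμa, ← hβ] at hμ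
    linarith

theorem isHyperbolicAt_rollWave (hθ : θ ∈ Set.Ioo 0 (Real.pi / 6)) (hμ₀ : 0 < μ₀)
    (hc₀ : 0 < c₀) (hK₀ : K₀ < 0) (hK₂ : K₂ < 0) (h : K₀ < K₂) (hμ : muOne β₂ K₀ K₂ < μ₀) {σ : ℝ}
    (hσ : σ = 1 ∨ σ = -1) :
    IsHyperbolicAt (leadingField θ μ₀ c₀ β₂ K₀ K₂) (rollWave μ₀ K₀ σ) := by
  have hs2 : (σ * √(-μ₀ / K₀)) ^ 2 = -μ₀ / K₀ := by
    rw [mul_pow, Real.sq_sqrt (div_nonneg_of_nonpos (by linarith) hK₀.le)]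
    rcases hσ with rfl | rfl <;> ring
  have hsK : μ₀ + K₀ * (σ * √(-μ₀ / K₀)) ^ 2 = 0 := by
    rw [hs2, mul_div_cancel₀ _ hK₀.ne, add_neg_cancel]
  refine isHyperbolicAt_of_reactionDeriv_injective β₂ K₀ K₂ hθ hc₀
    (reactionDeriv_roll_injective β₂ K₀ K₂ hμ₀.ne' hsK fun heq => ?_)
  rw [mul_pow β₂, hs2] at heq
  obtain ⟨hpos, hle, -⟩ := muOne_denominator_bounds hK₀ hK₂ h
  rw [muOne, div_lt_iff₀ hpos] at hμ
  set den := 2 * √2 * √(K₀ * (K₀ + K₂) ^ 3) - 2 * K₀ * (K₀ + 3 * K₂)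
  -- Vanishing of the block determinant, with `s² = -μ₀ / K₀`, fixes `μ₀` at a value not above
  -- `muOne`.
  have h2 : μ₀ * (K₀ - K₂) ^ 2 = -(β₂ ^ 2 * K₀) := by
    have := hK₀.ne
    field_simp at heq
    linear_combination heq
  have h3 : μ₀ * den ≤ μ₀ * (K₀ - K₂) ^ 2 := by gcongr
  linarith

end Equilibria

end HexInterface

theorem mainTheorem4
    (θ : ℝ) (hθ : θ ∈ Set.Ioo 0 (Real.pi / 6)) (hcot : ∃ q : ℚ, Real.cot θ = √3 * (q : ℝ))
    (μ₀ c₀ β₂ K₀ K₂ : ℝ) (hμ₀ : 0 < μ₀) (hc₀ : 0 < c₀)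
    (R : ℝ → HexInterface.Phase → (Fin 3 → ℝ)) (hR : HexInterface.IsOrderEps R) :
    -- the stable manifold of the trivial state is six-dimensional, that is, open in `ℝ⁶`
    IsOpen (HexInterface.stableManifold (HexInterface.leadingField θ μ₀ c₀ β₂ K₀ K₂) 0) ∧
    -- every heteroclinic orbit from a hyperbolic equilibrium to the trivial state persists
    (∀ (p : HexInterface.Phase) (γ : ℝ → HexInterface.Phase),
      HexInterface.IsHyperbolicAt (HexInterface.leadingField θ μ₀ c₀ β₂ K₀ K₂) p →
      HexInterface.IsHeteroclinic (HexInterface.leadingField θ μ₀ c₀ β₂ K₀ K₂) γ p 0 →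
      HexInterface.Persists (HexInterface.fullField θ μ₀ c₀ β₂ K₀ K₂ R) γ p) ∧
    -- in particular, orbits from down-hexagons or roll waves to the trivial state
    (0 ≤ β₂ → K₀ < 0 → K₂ < 0 →
      ((K₂ < K₀ ∨ (K₀ < K₂ ∧ μ₀ < HexInterface.muOne β₂ K₀ K₂)) →
        ∀ γ : ℝ → HexInterface.Phase,
          HexInterface.IsHeteroclinic (HexInterface.leadingField θ μ₀ c₀ β₂ K₀ K₂) γ
            (HexInterface.downHexagon μ₀ β₂ K₀ K₂) 0 →
          HexInterface.Persists (HexInterface.fullField θ μ₀ c₀ β₂ K₀ K₂ R) γ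
            (HexInterface.downHexagon μ₀ β₂ K₀ K₂)) ∧
      ((K₀ < K₂ ∧ HexInterface.muOne β₂ K₀ K₂ < μ₀) →
        ∀ σ : ℝ, σ = 1 ∨ σ = -1 → ∀ γ : ℝ → HexInterface.Phase,
          HexInterface.IsHeteroclinic (HexInterface.leadingField θ μ₀ c₀ β₂ K₀ K₂) γ
            (HexInterface.rollWave μ₀ K₀ σ) 0 →
          HexInterface.Persists (HexInterface.fullField θ μ₀ c₀ β₂ K₀ K₂ R) γ
            (HexInterface.rollWave μ₀ K₀ σ))) := by
  obtain ⟨m, M, a, hQ⟩ := HexInterface.exists_isLyapunovForm β₂ K₀ K₂ hθ hμ₀ hc₀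
  have hF := HexInterface.contDiff_leadingField θ μ₀ c₀ β₂ K₀ K₂
  have hF0 := HexInterface.leadingField_zero θ μ₀ c₀ β₂ K₀ K₂
  have hpersist : ∀ (p : HexInterface.Phase) (γ : ℝ → HexInterface.Phase),
      HexInterface.IsHyperbolicAt (HexInterface.leadingField θ μ₀ c₀ β₂ K₀ K₂) p →
      HexInterface.IsHeteroclinic (HexInterface.leadingField θ μ₀ c₀ β₂ K₀ K₂) γ p 0 →
      HexInterface.Persists (HexInterface.fullField θ μ₀ c₀ β₂ K₀ K₂ R) γ p :=
    fun p γ hp hγ => HexInterface.persists_of_lyapunovForm hF hF0 hQ hR hp hγ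
  exact ⟨HexInterface.isOpen_stableManifold_of_lyapunovForm hF hF0 hQ, hpersist,
    fun hβ₂ hK₀ hK₂ =>
      ⟨fun h γ hγ => hpersist _ γ
        (HexInterface.isHyperbolicAt_downHexagon hθ hμ₀ hc₀ hβ₂ hK₀ hK₂ h) hγ,
      fun h σ hσ γ hγ => hpersist _ γ
        (HexInterface.isHyperbolicAt_rollWave hθ hμ₀ hc₀ hK₀ hK₂ h.1 h.2 hσ) hγ⟩⟩
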